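/- **Theorem 3.3.** *Setting.* Let $d\ge 1$, let $Y_0\in[0,\infty)^d\setminus\{0\}$ be a fixed row vector and $p=(p_1,\dots,p_d)$ a fixed probability vector. On a probability space, let $X_m$ ($m\ge1$) be random unit row vectors ($X_m=e_k$ if the $m$-th draw is of type $k$), and $D_m=(D_{q,k}(m))_{q,k=1}^d$ ($m\ge 1$) random real matrices with integrable entries, not assumed independent, identically distributed or nonnegative. Put $$Y_m=Y_{m-1}+X_mD_m,\qquad N_n=\sum_{m=1}^nX_m,\qquad \mathscr F_n=\sigma(X_m,Y_m,D_m:\ 1\le m\le n).$$ For $y\in\mathbb R^d$ let $y^+=(\max(y_k,0))_k$, and read $y^+/\sum_j y_j^+$ as $p$ if $y^+=0$. Assume the selection rule $$\mathbb P(X_{n}=e_k\mid\mathscr F_{n-1})=\frac{Y_{n-1,k}^+}{\sum_{j}Y_{n-1,j}^+}\quad\text{a.s.},\qquad n\ge1,\ 1\le k\le d .$$ Let $H_m=\mathbb E[D_m\mid\mathscr F_{m-1}]$ and $M_{n,2}=\sum_{m=1}^nX_m(D_m-H_m)$; $\|\cdot\|$ denotes any fixed norm. For a real $d\times d$ matrix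 $H$ let $\lambda_H$ be the largest real part of its eigenvalues, and let $S_H$ be the set of row vectors $v$ with nonnegative entries summing to $1$ and $vH=\lambda_Hv$. *(i)* Let $H$ be a random matrix such that almost surely: $H_{q,k}\ge0$ for $q\ne k$; there is a column vector $u$ with strictly positive entries and $Hu=\lambda_Hu$; and $\lambda_H>0$ (here $\lambda_H,u,S_H$ may be random, and $H$ may be reducible). If $$\sum_{m=1}^\infty\frac{\|H_m-H\|}{m}<\infty\ \text{ a.s.}\qquad\text{and}\qquad \sum_{m=1}^\infty\frac{\max_{i\le m}\|M_{i,2}\|}{m^2}<\infty\ \text{ a.s.},\tag{$*$}$$ then there is a random vector $V$ with $V\in S_H$ a.s. such that, as $n\to\infty$, $$\frac{Y_n}{n}\to\lambda_HV,\qquad \frac{Y_n^+}{\sum_{j=1}^dY_{n,j}^+}\to V,\qquad \frac{N_n}{n}\to V\qquad\text{a.s.}$$ *(ii)* Suppose that, for every $m\ge1$, $X_m$ and $D_m$ are conditionally independent given $\mathscr F_{m-1}$. The second condition in $(*)$ holds if for all $q,k$ there are a sequence of real numbers $c_m=c_{m,q,k}>0$ and an $\epsilon>0$ such that $$\sum_{m=1}^\infty\frac{\mathbb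 E\big[|D_{q,k}(m)|\,I\{|D_{q,k}(m)|\ge c_m\}\,\big|\,\mathscr F_{m-1}\big]}{m}<\infty\quad\text{a.s.}$$ and $$\sum_{m=1}^\infty\frac{(\log m)^{1+\epsilon}\,\mathbb E\big[\widetilde D_{q,k}^2(m)\,\big|\,\mathscr F_{m-1}\big]}{m^2}<\infty\quad\text{a.s.},$$ where $\widetilde D_{q,k}(m)=D_{q,k}(m)I\{|D_{q,k}(m)|\le c_m\}-\mathbb E\big[D_{q,k}(m)I\{|D_{q,k}(m)|\le c_m\}\,\big|\,\mathscr F_{m-1}\big]$. -/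

import Mathlib

open MeasureTheory ProbabilityTheory Filter Topology

/- Norms: row vectors `Fin d → ℝ` and `d × d` matrices carry the maximum norm of the entries (in
finite dimension the choice of the norm is immaterial for every condition below). -/
attribute [local instance] Matrix.normedAddCommGroup

namespace Urn

/-- The Borel sigma-field on `d × d` real matrices, i.e. the product one over the entries. -/
instance instMeasurableSpaceMatrix {d : ℕ} : MeasurableSpace (Matrix (Fin d) (Fin d) ℝ) :=
  inferInstanceAs (MeasurableSpace (Fin d → Fin d → ℝ))

/-- `λ_H`: the largest real part of the (complex) eigenvalues of `H`. -/
noncomputable def lam {d : ℕ} (H : Matrix (Fin d) (Fin d) ℝ) : ℝ :=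
  sSup (Complex.re '' spectrum ℂ (H.map Complex.ofReal))

/-- `S_H`: the probability vectors `v` with `v H = λ_H v`. -/
def eigenSimplex {d : ℕ} (H : Matrix (Fin d) (Fin d) ℝ) : Set (Fin d → ℝ) :=
  {v | v ∈ stdSimplex ℝ (Fin d) ∧ Matrix.vecMul v H = lam H • v}

/-- The conditions on the limiting generating matrix; irreducibility is not required. -/
structure Admissible {d : ℕ} (H : Matrix (Fin d) (Fin d) ℝ) : Prop where
  offDiag_nonneg : ∀ q k, q ≠ k → 0 ≤ H q k
  exists_pos_eigenvector : ∃ u : Fin d → ℝ, (∀ k, 0 < u k) ∧ Matrix.mulVec H u = lam H • u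
  lam_pos : 0 < lam H

/-- The selection probabilities (proportions) `y⁺ / ∑ⱼ yⱼ⁺`, where `0 / 0` means `p`. -/
noncomputable def proportion {d : ℕ} (p y : Fin d → ℝ) : Fin d → ℝ :=
  if ∑ j, max (y j) 0 = 0 then p else fun k => max (y k) 0 / ∑ j, max (y j) 0

section Model

variable {Ω : Type*} {d : ℕ}

/-- `X_m`: the row vector with a `1` at the type drawn at stage `m` and `0` elsewhere. The stages
are `m = 1, 2, …`; the values `draw 0` and `D 0` are never used. -/
def X (draw : ℕ → Ω → Fin d) (m : ℕ) (ω : Ω) : Fin d → ℝ :=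
  Pi.single (draw m ω) 1

/-- The urn composition: `Y_0` is given and `Y_m = Y_{m-1} + X_m D_m`. -/
def Y (Y0 : Fin d → ℝ) (draw : ℕ → Ω → Fin d) (D : ℕ → Ω → Matrix (Fin d) (Fin d) ℝ) :
    ℕ → Ω → Fin d → ℝ
  | 0, _ => Y0
  | m + 1, ω => Y Y0 draw D m ω + Matrix.vecMul (X draw (m + 1) ω) (D (m + 1) ω)

/-- `N_n = ∑_{m=1}^n X_m`: the numbers of draws of each type in the first `n` stages. -/
def N (draw : ℕ → Ω → Fin d) (n : ℕ) (ω : Ω) : Fin d → ℝ :=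
  ∑ m ∈ Finset.Icc 1 n, X draw m ω

/-- `𝓕_n`: the sigma-field generated by `X_m, Y_m, D_m`, `m = 1, …, n`. -/
def history (Y0 : Fin d → ℝ) (draw : ℕ → Ω → Fin d) (D : ℕ → Ω → Matrix (Fin d) (Fin d) ℝ)
    (n : ℕ) : MeasurableSpace Ω :=
  ⨆ m ∈ Finset.Icc 1 n,
    (MeasurableSpace.comap (X draw m) inferInstance ⊔
      MeasurableSpace.comap (Y Y0 draw D m) inferInstance ⊔
      MeasurableSpace.comap (D m) inferInstance)

variable [MeasurableSpace Ω]

/-- The generalized Friedman urn with initial composition `Y0`, drawn types `draw m`, replacement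
matrices `D m` (not assumed independent or identically distributed) and default selection
probabilities `p`. -/
structure IsFriedmanUrn (μ : Measure Ω) (Y0 p : Fin d → ℝ) (draw : ℕ → Ω → Fin d)
    (D : ℕ → Ω → Matrix (Fin d) (Fin d) ℝ) : Prop where
  initial_nonneg : ∀ k, 0 ≤ Y0 k
  initial_ne_zero : Y0 ≠ 0
  default_mem : p ∈ stdSimplex ℝ (Fin d)
  measurable_draw : ∀ m, 1 ≤ m → Measurable (draw m)
  measurable_replacement : ∀ m, 1 ≤ m → Measurable (D m)
  integrable_replacement : ∀ m, 1 ≤ m → ∀ q k, Integrable (fun ω => D m ω q k) μ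
  selection : ∀ n k, μ[fun ω => X draw (n + 1) ω k | history Y0 draw D n]
    =ᵐ[μ] fun ω => proportion p (Y Y0 draw D n ω) k

/-- `condMean n` is `H_{n+1} = E[D_{n+1} | 𝓕_n]`, entry by entry. -/
noncomputable def condMean (μ : Measure Ω) (Y0 : Fin d → ℝ) (draw : ℕ → Ω → Fin d)
    (D : ℕ → Ω → Matrix (Fin d) (Fin d) ℝ) (n : ℕ) (ω : Ω) : Matrix (Fin d) (Fin d) ℝ :=
  Matrix.of fun q k => (μ[fun ω' => D (n + 1) ω' q k | history Y0 draw D n]) ω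

/-- `M_{n,2} = ∑_{m=1}^n X_m (D_m - E[D_m | 𝓕_{m-1}])`. -/
noncomputable def M2 (μ : Measure Ω) (Y0 : Fin d → ℝ) (draw : ℕ → Ω → Fin d)
    (D : ℕ → Ω → Matrix (Fin d) (Fin d) ℝ) (n : ℕ) (ω : Ω) : Fin d → ℝ :=
  ∑ m ∈ Finset.range n,
    Matrix.vecMul (X draw (m + 1) ω) (D (m + 1) ω - condMean μ Y0 draw D m ω)

/-- `max_{i ≤ m} ‖M_{i,2}‖` (with `M_{0,2} = 0`). -/
noncomputable def maxM2 (μ : Measure Ω) (Y0 : Fin d → ℝ) (draw : ℕ → Ω → Fin d)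
    (D : ℕ → Ω → Matrix (Fin d) (Fin d) ℝ) (m : ℕ) (ω : Ω) : ℝ :=
  (Finset.range (m + 1)).sup' Finset.nonempty_range_add_one fun i => ‖M2 μ Y0 draw D i ω‖

/-- `∑_{m ≥ 1} max_{i ≤ m} ‖M_{i,2}‖ / m² < ∞` almost surely. -/
def MartingaleCondition (μ : Measure Ω) (Y0 : Fin d → ℝ) (draw : ℕ → Ω → Fin d)
    (D : ℕ → Ω → Matrix (Fin d) (Fin d) ℝ) : Prop :=
  ∀ᵐ ω ∂μ, Summable fun m : ℕ => maxM2 μ Y0 draw D (m + 1) ω / ((m : ℝ) + 1) ^ 2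

/-- At every stage, the drawn type and the replacement matrix are conditionally independent given
the history: `P(draw_{n+1} = k, D_{n+1} ∈ B | 𝓕_n) = P(draw_{n+1} = k | 𝓕_n) P(D_{n+1} ∈ B | 𝓕_n)`
for all types `k` and Borel sets `B`. -/
def CondIndepDraws (μ : Measure Ω) (Y0 : Fin d → ℝ) (draw : ℕ → Ω → Fin d)
    (D : ℕ → Ω → Matrix (Fin d) (Fin d) ℝ) : Prop :=
  ∀ (n : ℕ) (k : Fin d) (B : Set (Matrix (Fin d) (Fin d) ℝ)), MeasurableSet B →
    μ[(draw (n + 1) ⁻¹' {k} ∩ D (n + 1) ⁻¹' B).indicator (fun _ => (1 : ℝ)) |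
        history Y0 draw D n]
    =ᵐ[μ] fun ω =>
      (μ[(draw (n + 1) ⁻¹' {k}).indicator (fun _ => (1 : ℝ)) | history Y0 draw D n]) ω *
      (μ[(D (n + 1) ⁻¹' B).indicator (fun _ => (1 : ℝ)) | history Y0 draw D n]) ω

/-- `D_{q,k}(m) I{|D_{q,k}(m)| ≤ c}`. -/
noncomputable def truncLe (D : ℕ → Ω → Matrix (Fin d) (Fin d) ℝ) (m : ℕ) (q k : Fin d) (c : ℝ) :
    Ω → ℝ :=
  {ω | |D m ω q k| ≤ c}.indicator fun ω => D m ω q k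

/-- `|D_{q,k}(m)| I{|D_{q,k}(m)| ≥ c}`. -/
noncomputable def tailGe (D : ℕ → Ω → Matrix (Fin d) (Fin d) ℝ) (m : ℕ) (q k : Fin d) (c : ℝ) :
    Ω → ℝ :=
  {ω | c ≤ |D m ω q k|}.indicator fun ω => |D m ω q k|

/-- The centered truncation at stage `n + 1`:
`D_{q,k}(n+1) I{|D_{q,k}(n+1)| ≤ c} - E[D_{q,k}(n+1) I{|D_{q,k}(n+1)| ≤ c} | 𝓕_n]`. -/
noncomputable def centeredTrunc (μ : Measure Ω) (Y0 : Fin d → ℝ) (draw : ℕ → Ω → Fin d)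
    (D : ℕ → Ω → Matrix (Fin d) (Fin d) ℝ) (n : ℕ) (q k : Fin d) (c : ℝ) (ω : Ω) : ℝ :=
  truncLe D (n + 1) q k c ω - (μ[truncLe D (n + 1) q k c | history Y0 draw D n]) ω

/-- The truncated-moment conditions. In both series the summand with index `n` is the one of stage
`m = n + 1`. -/
def TruncatedMomentCondition (μ : Measure Ω) (Y0 : Fin d → ℝ) (draw : ℕ → Ω → Fin d)
    (D : ℕ → Ω → Matrix (Fin d) (Fin d) ℝ) : Prop :=
  ∀ q k : Fin d, ∃ c : ℕ → ℝ, (∀ m, 0 < c m) ∧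
    (∀ᵐ ω ∂μ, Summable fun n : ℕ =>
      (μ[tailGe D (n + 1) q k (c (n + 1)) | history Y0 draw D n]) ω / ((n : ℝ) + 1)) ∧
    ∃ ε : ℝ, 0 < ε ∧ ∀ᵐ ω ∂μ, Summable fun n : ℕ =>
      Real.log ((n : ℝ) + 1) ^ (1 + ε) *
        (μ[fun ω' => centeredTrunc μ Y0 draw D n q k (c (n + 1)) ω' ^ 2 | history Y0 draw D n]) ω /
        ((n : ℝ) + 1) ^ 2

end Model

end Urn

/-! Part (i) reduces to a deterministic statement about single paths. Let P_n be the sum of the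
selection proportions up to stage n, the compensator of N_n. Then Y_n = P_n H + R_n, where R_n
collects Y_0, (N_n - P_n)H, M_{n,2} and the sum of X_m(H_m - H). Each piece is negligible, meaning
that its running maxima are summable against 1/n²: N_n - P_n because it is a martingale with bounded
increments, the others by (*).

For such a path, Y_n^+ - P_n H is negligible too. When a coordinate of Y_n is nonpositive its type
has proportion zero, so nonnegativity of the off-diagonal entries of H keeps that coordinate of P_n
H from decreasing. Otherwise it exceeds minus the error and can drop by at most ‖H‖ in one step.
Hence P_n H is never much below zero, and taking positive parts changes little
(`tendsto_of_proportion_drift`).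

Put Q_n = P_n u. The normalized path x_n = P_n / Q_n then follows an Euler scheme with generator G =
H - λ_H I, steps of order 1/n and summable errors. Since Gu = 0 with u > 0 and G has nonnegative
off-diagonal entries, I + tG is, for small t > 0, a contraction of the maximum norm weighted by 1/u.
So every nonzero eigenvalue of G has negative real part and 0 is semisimple. Components along stable
generalized eigenvectors die out, those along the kernel have summable increments, and x_n converges
to a left null vector of G, even for reducible H (`tendsto_of_perturbed_generator`).

For part (ii), D_m is split at c_m. The tails are summed absolutely. The centered truncations,
multiplied by X_m, are martingale differences by conditional independence. Doob's L² inequality,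
localized by conditional variances, bounds their maxima, and the logarithmic factor pays for passing
from squares to first powers (`ae_negligible_of_martingale_diff`). -/

namespace Urn

/-- A sequence whose running maxima `r n` satisfy `∑ r n / n² < ∞`. -/
def Negligible {E : Type*} [SeminormedAddCommGroup E] (s : ℕ → E) : Prop :=
  ∃ r : ℕ → ℝ, Monotone r ∧ (∀ n, ‖s n‖ ≤ r n) ∧
    Summable fun m : ℕ => r (m + 1) / ((m : ℝ) + 1) ^ 2

/-! ### Calculus of negligible sequences -/

section Negligible

variable {E F : Type*} [SeminormedAddCommGroup E] [SeminormedAddCommGroup F]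

theorem summable_inv_succ_sq : Summable fun m : ℕ => 1 / ((m : ℝ) + 1) ^ 2 := by
  have h := (summable_nat_add_iff 1).mpr (Real.summable_one_div_nat_pow.mpr (one_lt_two))
  simpa using h

/-- The bound is phrased through monotone majorants because in the application the value of `s` at n
depends on the whole past of `r`, not on `r n` alone. -/
theorem Negligible.of_le_add {s : ℕ → E} {r : ℕ → F} (hr : Negligible r) (a b : ℝ) (ha : 0 ≤ a)
    (h : ∀ r' : ℕ → ℝ, Monotone r' → (∀ n, ‖r n‖ ≤ r' n) → ∀ n, ‖s n‖ ≤ a * r' n + b) :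
    Negligible s := by
  obtain ⟨r', hm, hb, hs⟩ := hr
  refine ⟨fun n => a * r' n + b, fun i j hij => ?_, h r' hm hb, ?_⟩
  · have := mul_le_mul_of_nonneg_left (hm hij) ha
    simpa using this
  · have := (hs.mul_left a).add (summable_inv_succ_sq.mul_left b)
    refine this.congr fun m => ?_
    ring

theorem Negligible.mono {s : ℕ → E} {r : ℕ → F} (hr : Negligible r) (h : ∀ n, ‖s n‖ ≤ ‖r n‖) :
    Negligible s :=
  hr.of_le_add 1 0 zero_le_one fun r' _ hb n => by simpa using (h n).trans (hb n)

theorem negligible_const (c : E) : Negligible fun _ => c :=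
  ⟨fun _ => ‖c‖, monotone_const, fun _ => le_rfl, by
    simpa [div_eq_mul_inv] using summable_inv_succ_sq.mul_left ‖c‖⟩

theorem Negligible.add {s t : ℕ → E} (hs : Negligible s) (ht : Negligible t) :
    Negligible fun n => s n + t n := by
  obtain ⟨r, hm, hb, hr⟩ := hs
  obtain ⟨r', hm', hb', hr'⟩ := ht
  refine ⟨fun n => r n + r' n, hm.add hm', fun n => ?_, (hr.add hr').congr fun m => by ring⟩
  exact (norm_add_le _ _).trans (add_le_add (hb n) (hb' n))

theorem negligible_sum {ι : Type*} (S : Finset ι) {s : ι → ℕ → E}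
    (h : ∀ i ∈ S, Negligible (s i)) : Negligible fun n => ∑ i ∈ S, s i n := by
  classical
  induction S using Finset.induction_on with
  | empty => simpa using negligible_const (0 : E)
  | insert a S ha ih =>
    simp only [Finset.sum_insert ha]
    exact (h a (by simp)).add (ih fun i hi => h i (by simp [hi]))

theorem negligible_pi {ι : Type*} [Fintype ι] {s : ℕ → ι → ℝ}
    (h : ∀ i, Negligible fun n => s n i) : Negligible s := by
  have := negligible_sum Finset.univ (s := fun i n => |s n i|)
    fun i _ => (h i).mono fun n => by simp
  refine this.mono fun n => ?_
  rw [Real.norm_of_nonneg (Finset.sum_nonneg fun i _ => abs_nonneg _)]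
  refine (pi_norm_le_iff_of_nonneg (Finset.sum_nonneg fun i _ => abs_nonneg _)).mpr fun i => ?_
  rw [Real.norm_eq_abs]
  exact Finset.single_le_sum (f := fun i => |s n i|) (fun i _ => abs_nonneg _) (Finset.mem_univ i)

theorem negligible_iff_summable_sup' {s : ℕ → E} :
    Negligible s ↔ Summable fun m : ℕ =>
      ((Finset.range (m + 1 + 1)).sup' Finset.nonempty_range_add_one fun i => ‖s i‖) /
        ((m : ℝ) + 1) ^ 2 := by
  constructor
  · rintro ⟨r, hm, hb, hr⟩
    refine Summable.of_nonneg_of_le (fun m => ?_) (fun m => ?_) hr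
    · refine div_nonneg ((norm_nonneg (s 0)).trans ?_) (by positivity)
      exact Finset.le_sup' (fun i => ‖s i‖) (by simp)
    · gcongr
      refine Finset.sup'_le _ _ fun i hi => (hb i).trans (hm ?_)
      simp at hi; omega
  · intro h
    refine ⟨fun m => (Finset.range (m + 1)).sup' Finset.nonempty_range_add_one fun i => ‖s i‖,
      fun i j hij => ?_, fun n => ?_, h⟩
    · exact Finset.sup'_mono _ (by simpa using hij) _
    · exact Finset.le_sup' (fun i => ‖s i‖) (by simp)

/-- By monotonicity the block of the series over [n, 2n) is at least n · r(n)/(2n)², so r(n)/n is at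
most four times a block that tends to zero. -/
theorem Negligible.tendsto_div {s : ℕ → E} (hs : Negligible s) :
    Tendsto (fun n : ℕ => ‖s n‖ / n) atTop (𝓝 0) := by
  obtain ⟨r, hm, hb, hr⟩ := hs
  have h0 : ∀ n, 0 ≤ r n := fun n => (norm_nonneg _).trans (hb n)
  set f : ℕ → ℝ := fun m : ℕ => r (m + 1) / ((m : ℝ) + 1) ^ 2
  set T : ℕ → ℝ := fun n => ∑ m ∈ Finset.range n, f m
  have hT : Tendsto (fun n : ℕ => 4 * (T (2 * n) - T n)) atTop (𝓝 0) := by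
    have h1 := hr.hasSum.tendsto_sum_nat
    have h2 : Tendsto (fun n : ℕ => 2 * n) atTop atTop :=
      tendsto_id.const_mul_atTop' (by norm_num)
    simpa using ((h1.comp h2).sub h1).const_mul 4
  refine squeeze_zero' (Eventually.of_forall fun n => by positivity) ?_ hT
  filter_upwards [eventually_ge_atTop 1] with n hn
  have hn' : (1 : ℝ) ≤ n := by exact_mod_cast hn
  have h1 : T (2 * n) - T n = ∑ m ∈ Finset.Ico n (2 * n), f m := by
    rw [Finset.sum_Ico_eq_sub _ (by omega)]
  have h2 : ∑ m ∈ Finset.Ico n (2 * n), r n / (2 * n) ^ 2 ≤ ∑ m ∈ Finset.Ico n (2 * n), f m := by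
    refine Finset.sum_le_sum fun m hmem => ?_
    simp only [Finset.mem_Ico] at hmem
    have h3 : ((m : ℝ) + 1) ≤ 2 * n := by exact_mod_cast hmem.2
    exact div_le_div₀ (h0 _) (hm (by omega)) (by positivity) (by gcongr)
  rw [Finset.sum_const, Nat.card_Ico, nsmul_eq_mul] at h2
  have h3 : ((2 * n - n : ℕ) : ℝ) = n := by congr 1; omega
  rw [h3] at h2
  have h4 : r n / n = 4 * (n * (r n / (2 * n) ^ 2)) := by field_simp; ring
  rw [h1]
  calc ‖s n‖ / n ≤ r n / n := by gcongr; exact hb n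
    _ ≤ _ := by rw [h4]; gcongr

/-- Summation by parts for weighted partial sums. -/
theorem sum_mul_sum_le {h v σ : ℕ → ℝ} {C : ℝ} (hC : 0 ≤ C) (hh : ∀ n, 0 ≤ h n)
    (hv : ∀ n, v n ≤ C * (h n - h (n + 1))) (hσ : ∀ n, 0 ≤ σ n) (n : ℕ) :
    ∑ m ∈ Finset.range n, v m * ∑ i ∈ Finset.range (m + 1), σ i ≤
      C * ∑ i ∈ Finset.range n, h i * σ i := by
  have key : ∀ n, ∑ m ∈ Finset.range n, (h m - h (m + 1)) * ∑ i ∈ Finset.range (m + 1), σ i +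
      h n * ∑ i ∈ Finset.range n, σ i = ∑ i ∈ Finset.range n, h i * σ i := by
    intro n
    induction n with
    | zero => simp
    | succ n ih =>
      rw [Finset.sum_range_succ, Finset.sum_range_succ _ n, Finset.sum_range_succ (fun i => h i * σ i),
        ← ih]
      ring
  have h1 : ∑ m ∈ Finset.range n, v m * ∑ i ∈ Finset.range (m + 1), σ i ≤
      ∑ m ∈ Finset.range n, C * ((h m - h (m + 1)) * ∑ i ∈ Finset.range (m + 1), σ i) := by
    refine Finset.sum_le_sum fun m _ => ?_
    rw [← mul_assoc]
    exact mul_le_mul_of_nonneg_right (hv m) (Finset.sum_nonneg fun i _ => hσ i)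
  refine h1.trans ?_
  rw [← Finset.mul_sum]
  refine mul_le_mul_of_nonneg_left ?_ hC
  rw [← key n]
  have := mul_nonneg (hh n) (Finset.sum_nonneg (s := Finset.range n) fun i _ => hσ i)
  linarith

/-- Interchange of summation: the tail of ∑ 1/m² from i on is of order 1/i. The constant 2 comes
from n + 2 ≤ 2(n + 1). -/
theorem negligible_partial_sums {η : ℕ → E} (h : Summable fun n : ℕ => ‖η n‖ / ((n : ℝ) + 1)) :
    Negligible fun n => ∑ i ∈ Finset.range n, η i := by
  refine ⟨fun n => ∑ i ∈ Finset.range n, ‖η i‖, fun i j hij => ?_, fun n => norm_sum_le _ _, ?_⟩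
  · exact Finset.sum_le_sum_of_subset_of_nonneg (by simpa using hij) fun _ _ _ => norm_nonneg _
  · refine summable_of_sum_range_le (c := 2 * ∑' n : ℕ, ‖η n‖ / ((n : ℝ) + 1))
      (fun n => div_nonneg (Finset.sum_nonneg fun _ _ => norm_nonneg _) (by positivity)) fun n => ?_
    have := sum_mul_sum_le (h := fun n : ℕ => 1 / ((n : ℝ) + 1))
      (v := fun n : ℕ => 1 / ((n : ℝ) + 1) ^ 2) (σ := fun n => ‖η n‖) (C := 2) zero_le_two
      (fun n => by positivity) (fun n => by
        push_cast
        rw [div_sub_div _ _ (by positivity) (by positivity), mul_div_assoc', div_le_div_iff₀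
          (by positivity) (by positivity)]
        nlinarith [(Nat.cast_nonneg n : (0 : ℝ) ≤ n)]) (fun n => norm_nonneg _) n
    calc _ = ∑ m ∈ Finset.range n, 1 / ((m : ℝ) + 1) ^ 2 * ∑ i ∈ Finset.range (m + 1), ‖η i‖ :=
          Finset.sum_congr rfl fun m _ => by ring
      _ ≤ _ := this
      _ ≤ _ := by
        refine mul_le_mul_of_nonneg_left ?_ zero_le_two
        simp only [one_div_mul_eq_div]
        exact h.sum_le_tsum _ fun i _ => by positivity

end Negligible

/-! ### Scalar recursions and perturbed Euler schemes -/

section Recursion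

theorem tendsto_zero_of_le_mul {y τ : ℕ → ℝ} (hτ : ∀ᶠ n in atTop, 0 ≤ τ n ∧ τ n ≤ 1)
    (hdiv : Tendsto (fun n => ∑ i ∈ Finset.range n, τ i) atTop atTop) (hy : ∀ n, 0 ≤ y n)
    (h : ∀ᶠ n in atTop, y (n + 1) ≤ (1 - τ n) * y n) : Tendsto y atTop (𝓝 0) := by
  obtain ⟨n₀, hn₀⟩ := eventually_atTop.mp (hτ.and h)
  have key : ∀ n ≥ n₀, y n ≤ y n₀ * Real.exp (∑ i ∈ Finset.range n₀, τ i) *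
      Real.exp (-∑ i ∈ Finset.range n, τ i) := by
    intro n hn
    induction n, hn using Nat.le_induction with
    | base => rw [mul_assoc, ← Real.exp_add]; simp
    | succ n hn ih =>
      obtain ⟨⟨h0, h1⟩, h2⟩ := hn₀ n hn
      rw [Finset.sum_range_succ, neg_add, Real.exp_add, ← mul_assoc]
      calc y (n + 1) ≤ (1 - τ n) * y n := h2
        _ ≤ Real.exp (-τ n) * y n := by
          gcongr
          · exact hy n
          · linarith [Real.add_one_le_exp (-τ n)]
        _ ≤ _ := by rw [mul_comm]; gcongr
  refine squeeze_zero' (Eventually.of_forall hy) (eventually_atTop.mpr ⟨n₀, key⟩) ?_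
  have := (Real.tendsto_exp_neg_atTop_nhds_zero.comp hdiv).const_mul
    (y n₀ * Real.exp (∑ i ∈ Finset.range n₀, τ i))
  simpa using this

/-- Once b < ε/2, the excess of y over ε/2 obeys the homogeneous recursion, since the right side is
a convex combination of y and b. -/
theorem tendsto_zero_of_le_mul_add {y τ b : ℕ → ℝ} (hτ : ∀ᶠ n in atTop, 0 ≤ τ n ∧ τ n ≤ 1)
    (hdiv : Tendsto (fun n => ∑ i ∈ Finset.range n, τ i) atTop atTop) (hy : ∀ n, 0 ≤ y n)
    (hb : Tendsto b atTop (𝓝 0))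
    (h : ∀ᶠ n in atTop, y (n + 1) ≤ (1 - τ n) * y n + τ n * b n) : Tendsto y atTop (𝓝 0) := by
  refine tendsto_order.mpr ⟨fun a ha => Eventually.of_forall fun n => ha.trans_le (hy n),
    fun ε hε => ?_⟩
  have h1 := tendsto_zero_of_le_mul (y := fun n => max (y n - ε / 2) 0) hτ hdiv
    (fun n => le_max_right _ _) (by
      filter_upwards [h, hτ, hb.eventually_lt_const (half_pos hε)] with n h1 h2 h3
      have h4 := le_max_left (y n - ε / 2) 0
      have h5 := le_max_right (y n - ε / 2) 0
      refine max_le ?_ (mul_nonneg (by linarith) h5)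
      have h6 : τ n * b n ≤ τ n * (ε / 2) := mul_le_mul_of_nonneg_left h3.le h2.1
      have h7 := mul_le_mul_of_nonneg_left h4 (sub_nonneg.mpr h2.2)
      linarith)
  filter_upwards [h1.eventually_lt_const (half_pos hε)] with n hn
  linarith [le_max_left (y n - ε / 2) 0]

theorem tendsto_zero_of_recursion {φ ψ s : ℕ → ℂ} {t : ℕ → ℝ} {μ : ℂ} (hμ : μ.re < 0)
    (ht0 : ∀ n, 0 ≤ t n) (ht : Tendsto t atTop (𝓝 0))
    (hdiv : Tendsto (fun n => ∑ i ∈ Finset.range n, t i) atTop atTop)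
    (hψ : Tendsto ψ atTop (𝓝 0)) (hs : Summable fun n => ‖s n‖)
    (h : ∀ n, φ (n + 1) = (1 + t n * μ) * φ n + t n * ψ n + s n) : Tendsto φ atTop (𝓝 0) := by
  set c : ℝ := -μ.re / 2
  have hc : 0 < c := by simp only [c]; linarith
  -- Adding the remaining error mass `e n` to ‖φ n‖ absorbs the summable perturbation: what enters
  -- through `s n` leaves through `e`.
  set e : ℕ → ℝ := fun n => ∑' k, ‖s (k + n)‖
  have he : Tendsto e atTop (𝓝 0) := tendsto_sum_nat_add fun n => ‖s n‖
  have he0 : ∀ n, 0 ≤ e n := fun n => tsum_nonneg fun _ => norm_nonneg _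
  have hes : ∀ n, e n = ‖s n‖ + e (n + 1) := by
    intro n
    have := ((summable_nat_add_iff n).mpr hs).tsum_eq_zero_add
    simp only [e]
    rw [this]
    simp [add_assoc, add_comm 1 n]
  have hmul : ∀ᶠ n in atTop, ‖1 + t n * μ‖ ≤ 1 - c * t n := by
    -- With Re μ = -2c this gives |1 + tμ|² = 1 - 4ct + t²|μ|² ≤ 1 - 3ct ≤ (1 - ct)².
    have h1 : ∀ᶠ n in atTop, t n * ‖μ‖ ^ 2 < c := by
      have := (ht.mul_const (‖μ‖ ^ 2))
      rw [zero_mul] at this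
      exact this.eventually_lt_const hc
    have h2 : ∀ᶠ n in atTop, c * t n < 1 := by
      have := (ht.const_mul c)
      rw [mul_zero] at this
      exact this.eventually_lt_const one_pos
    filter_upwards [h1, h2] with n h1 h2
    refine abs_le_of_sq_le_sq' ?_ (by linarith) |>.2
    rw [← Complex.normSq_eq_norm_sq] at h1 ⊢
    simp only [Complex.normSq_apply, Complex.add_re, Complex.one_re, Complex.re_ofReal_mul,
      Complex.add_im, Complex.one_im, Complex.im_ofReal_mul] at h1 ⊢
    have h3 := mul_le_mul_of_nonneg_left h1.le (ht0 n)
    have h4 : μ.re = -2 * c := by simp only [c]; ring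
    have h5 : t n * μ.re = -2 * (c * t n) := by rw [h4]; ring
    nlinarith [sq_nonneg (c * t n), mul_nonneg hc.le (ht0 n)]
  have hy := tendsto_zero_of_le_mul_add (y := fun n => ‖φ n‖ + e n) (τ := fun n => c * t n)
    (b := fun n => ‖ψ n‖ / c + e n) ?_ ?_ (fun n => add_nonneg (norm_nonneg _) (he0 n)) ?_ ?_
  · refine squeeze_zero_norm (fun n => ?_) hy
    linarith [he0 n]
  · have h2 : ∀ᶠ n in atTop, c * t n < 1 := by
      have := (ht.const_mul c)
      rw [mul_zero] at this
      exact this.eventually_lt_const one_pos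
    filter_upwards [h2] with n hn
    exact ⟨mul_nonneg hc.le (ht0 n), hn.le⟩
  · simp only [← Finset.mul_sum]
    exact hdiv.const_mul_atTop hc
  · simpa using (hψ.norm.div_const c).add he
  · filter_upwards [hmul] with n hn
    have h1 : ‖φ (n + 1)‖ ≤ (1 - c * t n) * ‖φ n‖ + t n * ‖ψ n‖ + ‖s n‖ := by
      rw [h n]
      refine (norm_add₃_le).trans ?_
      rw [norm_mul, norm_mul, Complex.norm_real, Real.norm_of_nonneg (ht0 n)]
      gcongr
    have h2 : c * t n * (‖ψ n‖ / c) = t n * ‖ψ n‖ := by field_simp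
    simp only [mul_add, h2]
    rw [hes n] at *
    linarith

/-- Linear functionals following a perturbed Euler scheme `L (n + 1) = L n ∘ (1 + t n • f) + …` for
a stable semisimple-at-zero generator `f` converge to functionals vanishing on the range of `f`. -/
theorem tendsto_of_perturbed_euler {E : Type*} [AddCommGroup E] [Module ℂ E]
    [FiniteDimensional ℂ E] {f : Module.End ℂ E}
    (hf : ∀ μ, f.HasEigenvalue μ → μ = 0 ∨ μ.re < 0) (hf0 : ∀ v, f (f v) = 0 → f v = 0)
    {L : ℕ → E →ₗ[ℂ] ℂ} {t : ℕ → ℝ} (ht0 : ∀ n, 0 ≤ t n) (ht : Tendsto t atTop (𝓝 0))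
    (hdiv : Tendsto (fun n => ∑ i ∈ Finset.range n, t i) atTop atTop)
    (hs : ∀ v, Summable fun n => ‖L (n + 1) v - L n v - t n * L n (f v)‖) (v : E) :
    (∃ l, Tendsto (fun n => L n v) atTop (𝓝 l)) ∧ Tendsto (fun n => L n (f v)) atTop (𝓝 0) := by
  -- Writing f v = μ v + (f - μ)v, the second term has lower nilpotency order, so by induction it
  -- contributes the vanishing input ψ of the scalar recursion.
  have hstable : ∀ μ : ℂ, μ.re < 0 → ∀ (k : ℕ) (v : E), ((f - μ • 1) ^ k) v = 0 →
      Tendsto (fun n => L n v) atTop (𝓝 0) := by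
    intro μ hμ k
    induction k with
    | zero => intro v hv; simp at hv; simp [hv]
    | succ k ih =>
      intro v hv
      rw [pow_succ, Module.End.mul_apply] at hv
      refine tendsto_zero_of_recursion hμ ht0 ht hdiv (ih _ hv) (hs v) fun n => ?_
      simp
      ring
  have hv : v ∈ ⨆ μ, f.maxGenEigenspace μ := by
    rw [Module.End.iSup_maxGenEigenspace_eq_top]; trivial
  induction hv using Submodule.iSup_induction' with
  | zero => simp
  | add v w _ _ hv hw =>
    obtain ⟨⟨l, hl⟩, hv⟩ := hv
    obtain ⟨⟨l', hl'⟩, hw⟩ := hw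
    simp only [map_add]
    exact ⟨⟨l + l', hl.add hl'⟩, by simpa using hv.add hw⟩
  | mem μ v hv =>
    obtain ⟨k, hk⟩ := (Module.End.mem_maxGenEigenspace f μ v).mp hv
    by_cases hμ : f.HasEigenvalue μ
    · rcases hf μ hμ with rfl | hre
      -- Semisimplicity at 0 turns a generalized null vector into a genuine one; the drift then
      -- disappears and the increments of `L n v` are summable.
      · have hfv : f v = 0 := by
          simp only [zero_smul, sub_zero] at hk
          clear hv
          induction k generalizing v with
          | zero => simp at hk; simp [hk]
          | succ k ih =>
            rw [pow_succ, Module.End.mul_apply] at hk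
            exact hf0 v (ih _ hk)
        have h1 := (hs v).of_norm.hasSum.tendsto_sum_nat
        simp only [hfv, map_zero, mul_zero, sub_zero, Finset.sum_range_sub (fun n => L n v)] at h1
        exact ⟨⟨_, by simpa using h1.add_const (L 0 v)⟩, by simp [hfv]⟩
      · refine ⟨⟨0, hstable μ hre k v hk⟩, hstable μ hre k _ ?_⟩
        have hc : Commute ((f - μ • 1) ^ k) f :=
          (((Commute.refl f).sub_left ((Commute.one_left f).smul_left μ))).pow_left k
        rw [← Module.End.mul_apply, hc.eq, Module.End.mul_apply, hk, map_zero]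
    · have : v = 0 := by
        by_contra hv0
        apply hμ
        refine Module.End.hasEigenvalue_of_hasGenEigenvalue (k := k) (μ := μ) ?_
        intro h
        have : v ∈ f.genEigenspace μ k := by
          rw [Module.End.mem_genEigenspace_nat]; exact hk
        rw [h] at this
        exact hv0 (by simpa using this)
      simp [this]

end Recursion

open Matrix

theorem Negligible.summable {E : Type*} [SeminormedAddCommGroup E] {s : ℕ → E}
    (hs : Negligible s) : Summable fun n : ℕ => ‖s n‖ / (n : ℝ) ^ 2 := by
  obtain ⟨r, _, hb, hr⟩ := hs
  refine (summable_nat_add_iff 1).mp ?_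
  refine Summable.of_nonneg_of_le (fun n => by positivity) (fun n => ?_) hr
  push_cast
  gcongr
  exact hb _

/-! ### Spectrum of a generator with a positive null vector -/

section Generator

variable {d : ℕ} {G : Matrix (Fin d) (Fin d) ℝ} {u : Fin d → ℝ}

/-- The matrix I + tG is entrywise nonnegative and fixes u, so it preserves every ball of the
maximum norm weighted by 1/u. -/
theorem norm_add_smul_mulVec_le (hoff : ∀ q k, q ≠ k → 0 ≤ G q k) (hG : G *ᵥ u = 0)
    {t : ℝ} (ht : 0 ≤ t) (hdiag : ∀ k, 0 ≤ 1 + t * G k k) {v : Fin d → ℂ} {C : ℝ}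
    (hv : ∀ k, ‖v k‖ ≤ C * u k) (k : Fin d) :
    ‖v k + t * (G.map Complex.ofReal *ᵥ v) k‖ ≤ C * u k := by
  have hA : ∀ j, 0 ≤ (1 : Matrix (Fin d) (Fin d) ℝ) k j + t * G k j := by
    intro j
    by_cases h : k = j
    · subst h; simpa using hdiag k
    · simpa [Matrix.one_apply_ne h] using mul_nonneg ht (hoff k j h)
  have h1 : v k + t * (G.map Complex.ofReal *ᵥ v) k =
      ∑ j, (((1 : Matrix (Fin d) (Fin d) ℝ) k j + t * G k j : ℝ) : ℂ) * v j := by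
    simp only [Matrix.mulVec, dotProduct, Matrix.map_apply, Complex.ofReal_add,
      Complex.ofReal_mul, add_mul, Finset.sum_add_distrib, Finset.mul_sum, mul_assoc]
    congr 1
    simp [Matrix.one_apply, apply_ite Complex.ofReal]
  have h2 : C * u k = ∑ j, ((1 : Matrix (Fin d) (Fin d) ℝ) k j + t * G k j) * (C * u j) := by
    have h3 : ∑ j, G k j * u j = 0 := congrFun hG k
    have h4 : ∑ j, t * G k j * (C * u j) = t * C * ∑ j, G k j * u j := by
      rw [Finset.mul_sum]; exact Finset.sum_congr rfl fun _ _ => by ring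
    simp only [add_mul, Finset.sum_add_distrib, h4, h3]
    simp [Matrix.one_apply]
  rw [h1, h2]
  refine (norm_sum_le _ _).trans (Finset.sum_le_sum fun j _ => ?_)
  rw [norm_mul, Complex.norm_real, Real.norm_of_nonneg (hA j)]
  exact mul_le_mul_of_nonneg_left (hv j) (hA j)

theorem exists_pos_diag_nonneg (G : Matrix (Fin d) (Fin d) ℝ) :
    ∃ t : ℝ, 0 < t ∧ ∀ k, 0 ≤ 1 + t * G k k := by
  have h0 : 0 ≤ ∑ k, |G k k| := Finset.sum_nonneg fun _ _ => abs_nonneg _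
  refine ⟨1 / (1 + ∑ k, |G k k|), by positivity, fun k => ?_⟩
  have h1 : |G k k| ≤ ∑ k, |G k k| :=
    Finset.single_le_sum (f := fun k => |G k k|) (fun _ _ => abs_nonneg _) (Finset.mem_univ k)
  have h2 : -1 ≤ 1 / (1 + ∑ k, |G k k|) * G k k := by
    rw [one_div_mul_eq_div, le_div_iff₀ (by positivity)]
    linarith [neg_abs_le (G k k)]
  linarith

/-- At a coordinate maximizing |w_k|/u_k the contraction gives |1 + tμ| ≤ 1, that is 2t Re μ +
t²|μ|² ≤ 0. -/
theorem eigenvalue_re_neg (hoff : ∀ q k, q ≠ k → 0 ≤ G q k) (hu : ∀ k, 0 < u k)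
    (hG : G *ᵥ u = 0) {μ : ℂ} {w : Fin d → ℂ} (hw0 : w ≠ 0)
    (hw : G.map Complex.ofReal *ᵥ w = μ • w) : μ = 0 ∨ μ.re < 0 := by
  obtain ⟨t, ht, hdiag⟩ := exists_pos_diag_nonneg G
  obtain ⟨i, hi⟩ := Function.ne_iff.mp hw0
  obtain ⟨k, -, hk⟩ := Finset.exists_max_image Finset.univ (fun k => ‖w k‖ / u k)
    ⟨i, Finset.mem_univ i⟩
  have hwk : 0 < ‖w k‖ := by
    have h1 : 0 < ‖w i‖ / u i := div_pos (norm_pos_iff.mpr hi) (hu i)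
    exact (div_pos_iff_of_pos_right (hu k)).mp (h1.trans_le (hk i (Finset.mem_univ i)))
  have h1 := norm_add_smul_mulVec_le hoff hG ht.le hdiag (v := w) (C := ‖w k‖ / u k)
    (fun j => (div_le_iff₀ (hu j)).mp (hk j (Finset.mem_univ j))) k
  rw [hw, div_mul_cancel₀ _ (hu k).ne'] at h1
  have h2 : w k + t * (μ • w) k = (1 + t * μ) * w k := by simp; ring
  rw [h2, norm_mul] at h1
  have h3 : ‖1 + t * μ‖ ≤ 1 := by
    by_contra h
    push Not at h
    nlinarith
  have h4 : ‖1 + t * μ‖ ^ 2 ≤ 1 := pow_le_one₀ (norm_nonneg _) h3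
  rw [← Complex.normSq_eq_norm_sq] at h4
  simp only [Complex.normSq_apply, Complex.add_re, Complex.one_re, Complex.re_ofReal_mul,
    Complex.add_im, Complex.one_im, Complex.im_ofReal_mul] at h4
  by_contra! h
  obtain ⟨hne, hre⟩ := h
  have h5 : 0 ≤ t * μ.re := mul_nonneg ht.le hre
  have h6 : t * μ.re = 0 := by nlinarith [sq_nonneg (t * μ.re), sq_nonneg (t * μ.im)]
  have h7 : t * μ.im = 0 := by
    rw [h6] at h4
    nlinarith [sq_nonneg (t * μ.im)]
  apply hne
  apply Complex.ext
  · simpa [ht.ne'] using h6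
  · simpa [ht.ne'] using h7

/-- If G²v = 0 then (I + tG)^n v = v + n t Gv. The contraction bounds this in n, which forces Gv =
0: a Jordan block at 0 would grow linearly. -/
theorem mulVec_eq_zero_of_sq (hoff : ∀ q k, q ≠ k → 0 ≤ G q k) (hu : ∀ k, 0 < u k)
    (hG : G *ᵥ u = 0) {v : Fin d → ℂ}
    (hv : G.map Complex.ofReal *ᵥ (G.map Complex.ofReal *ᵥ v) = 0) :
    G.map Complex.ofReal *ᵥ v = 0 := by
  obtain ⟨t, ht, hdiag⟩ := exists_pos_diag_nonneg G
  set w := G.map Complex.ofReal *ᵥ v with hw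
  set C := ∑ k, ‖v k‖ / u k
  have hC : ∀ n : ℕ, ∀ k, ‖(v + (n * t : ℂ) • w) k‖ ≤ C * u k := by
    intro n
    induction n with
    | zero =>
      intro k
      simp only [Nat.cast_zero, zero_mul, zero_smul, add_zero]
      rw [← div_le_iff₀ (hu k)]
      exact Finset.single_le_sum (f := fun k => ‖v k‖ / u k)
        (fun k _ => div_nonneg (norm_nonneg _) (hu k).le) (Finset.mem_univ k)
    | succ n ih =>
      intro k
      have := norm_add_smul_mulVec_le hoff hG ht.le hdiag ih k
      rw [Matrix.mulVec_add, Matrix.mulVec_smul, hv, ← hw] at this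
      convert this using 2
      simp
      ring
  ext k
  by_contra hne
  have hpos : 0 < ‖w k‖ := norm_pos_iff.mpr hne
  obtain ⟨n, hn⟩ := exists_nat_gt ((C * u k + ‖v k‖) / (t * ‖w k‖))
  rw [div_lt_iff₀ (by positivity)] at hn
  have h1 := hC n k
  have h2 : ‖(n * t : ℂ) * w k‖ = n * (t * ‖w k‖) := by
    rw [norm_mul, norm_mul, Complex.norm_natCast, Complex.norm_real, Real.norm_of_nonneg ht.le]
    ring
  have h3 := norm_sub_le ((v + (n * t : ℂ) • w) k) (v k)
  simp only [Pi.add_apply, Pi.smul_apply, smul_eq_mul, add_sub_cancel_left, h2] at h1 h3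
  linarith

theorem tendsto_of_perturbed_generator (hoff : ∀ q k, q ≠ k → 0 ≤ G q k) (hu : ∀ k, 0 < u k)
    (hG : G *ᵥ u = 0) {x : ℕ → Fin d → ℝ} {t : ℕ → ℝ} (ht0 : ∀ n, 0 ≤ t n)
    (ht : Tendsto t atTop (𝓝 0))
    (hdiv : Tendsto (fun n => ∑ i ∈ Finset.range n, t i) atTop atTop)
    (hs : Summable fun n => ‖x (n + 1) - x n - t n • (x n ᵥ* G)‖) :
    ∃ y, Tendsto x atTop (𝓝 y) ∧ y ᵥ* G = 0 := by
  set f : Module.End ℂ (Fin d → ℂ) := Matrix.mulVecLin (G.map Complex.ofReal)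
  -- Row vectors are read as functionals on complex columns, so that right multiplication by G
  -- becomes composition with f and generalized eigenspaces are available.
  set L : ℕ → (Fin d → ℂ) →ₗ[ℂ] ℂ := fun n => ∑ k, (x n k : ℂ) • LinearMap.proj k
  have hL : ∀ n v, L n v = ∑ k, (x n k : ℂ) * v k := by
    intro n v; simp [L]
  have hLf : ∀ n v, L n (f v) = ∑ k, ((x n ᵥ* G) k : ℂ) * v k := by
    intro n v
    have := Matrix.dotProduct_mulVec (fun k => (x n k : ℂ)) (G.map Complex.ofReal) v
    simp only [dotProduct] at this
    rw [hL, show f v = G.map Complex.ofReal *ᵥ v from rfl, this]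
    simp [Matrix.vecMul, dotProduct]
  have key := tendsto_of_perturbed_euler (f := f) (L := L) (t := t) (fun μ hμ => ?_) (fun v hv => ?_)
    ht0 ht hdiv (fun v => ?_)
  · have h1 : ∀ j, ∃ l, Tendsto (fun n => x n j) atTop (𝓝 l) := by
      intro j
      obtain ⟨l, hl⟩ := (key (Pi.single j 1)).1
      refine ⟨l.re, ?_⟩
      have := (Complex.continuous_re.tendsto l).comp hl
      refine this.congr fun n => ?_
      simp [hL, Pi.single_apply]
    choose y hy using h1
    have hxy : Tendsto x atTop (𝓝 y) := tendsto_pi_nhds.mpr hy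
    refine ⟨y, hxy, ?_⟩
    ext j
    have h2 := (Complex.continuous_re.tendsto 0).comp (key (Pi.single j 1)).2
    have h3 : Tendsto (fun n => (x n ᵥ* G) j) atTop (𝓝 ((y ᵥ* G) j)) := by
      have hc : Continuous fun z : Fin d → ℝ => (z ᵥ* G) j := by
        simp only [Matrix.vecMul, dotProduct]; fun_prop
      exact (hc.tendsto y).comp hxy
    refine tendsto_nhds_unique h3 (h2.congr fun n => ?_)
    simp [hLf, Pi.single_apply]
  · obtain ⟨w, hw⟩ := hμ.exists_hasEigenvector
    exact eigenvalue_re_neg hoff hu hG hw.2 hw.apply_eq_smul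
  · exact mulVec_eq_zero_of_sq hoff hu hG hv
  · refine Summable.of_nonneg_of_le (fun n => norm_nonneg _) (fun n => ?_)
      (hs.mul_right (∑ k, ‖v k‖))
    have h1 : L (n + 1) v - L n v - t n * L n (f v) =
        ∑ k, (((x (n + 1) - x n - t n • (x n ᵥ* G)) k : ℝ) : ℂ) * v k := by
      rw [hL, hL, hLf, Finset.mul_sum, ← Finset.sum_sub_distrib, ← Finset.sum_sub_distrib]
      refine Finset.sum_congr rfl fun k _ => ?_
      simp
      ring
    rw [h1, Finset.mul_sum]
    refine (norm_sum_le _ _).trans (Finset.sum_le_sum fun k _ => ?_)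
    rw [norm_mul, Complex.norm_real]
    gcongr
    exact norm_le_pi_norm _ k

end Generator

/-! ### Deterministic convergence of the compensated path -/

section Drift

variable {d : ℕ}

theorem proportion_mem_stdSimplex {p : Fin d → ℝ} (hp : p ∈ stdSimplex ℝ (Fin d))
    (y : Fin d → ℝ) : proportion p y ∈ stdSimplex ℝ (Fin d) := by
  unfold proportion
  split_ifs with h
  · exact hp
  · have h0 : 0 ≤ ∑ j, max (y j) 0 := Finset.sum_nonneg fun _ _ => le_max_right _ _
    refine ⟨fun k => div_nonneg (le_max_right _ _) h0, ?_⟩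
    rw [← Finset.sum_div, div_self h]

theorem abs_vecMul_le {v : Fin d → ℝ} (hv : v ∈ stdSimplex ℝ (Fin d))
    (H : Matrix (Fin d) (Fin d) ℝ) (k : Fin d) : |(v ᵥ* H) k| ≤ ‖H‖ := by
  calc |(v ᵥ* H) k| ≤ ∑ q, |v q * H q k| := by
        change |∑ q, v q * H q k| ≤ _
        exact Finset.abs_sum_le_sum_abs _ _
    _ ≤ ∑ q, v q * ‖H‖ := by
      refine Finset.sum_le_sum fun q _ => ?_
      rw [abs_mul, abs_of_nonneg (hv.1 q)]
      exact mul_le_mul_of_nonneg_left (H.norm_entry_le_entrywise_sup_norm) (hv.1 q)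
    _ = ‖H‖ := by rw [← Finset.sum_mul, hv.2, one_mul]

theorem abs_dotProduct_le (v : Fin d → ℝ) {u : Fin d → ℝ} (hu : ∀ k, 0 < u k) :
    |v ⬝ᵥ u| ≤ ‖v‖ * ∑ k, u k := by
  rw [Finset.mul_sum]
  refine (Finset.abs_sum_le_sum_abs _ _).trans (Finset.sum_le_sum fun k _ => ?_)
  rw [abs_mul, abs_of_pos (hu k)]
  exact mul_le_mul_of_nonneg_right (norm_le_pi_norm v k) (hu k).le

/-- A path whose increments are the proportions of a small perturbation of its image under `H`
converges, after normalization, to a normalized left eigenvector. -/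
theorem tendsto_of_proportion_drift {H : Matrix (Fin d) (Fin d) ℝ} {l : ℝ} {u p : Fin d → ℝ}
    (hoff : ∀ q k, q ≠ k → 0 ≤ H q k) (hu : ∀ k, 0 < u k) (hHu : H *ᵥ u = l • u) (hl : 0 < l)
    (hp : p ∈ stdSimplex ℝ (Fin d)) {Y P R : ℕ → Fin d → ℝ} (hP0 : P 0 = 0)
    (hP : ∀ n, P (n + 1) = P n + proportion p (Y n)) (hY : ∀ n, Y n = P n ᵥ* H + R n)
    (hR : Negligible R) :
    ∃ v ∈ stdSimplex ℝ (Fin d), v ᵥ* H = l • v ∧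
      Tendsto (fun n : ℕ => (n : ℝ)⁻¹ • P n) atTop (𝓝 v) := by
  have hπ := fun n => proportion_mem_stdSimplex hp (Y n)
  have hPnn : ∀ n k, 0 ≤ P n k := by
    intro n
    induction n with
    | zero => simp [hP0]
    | succ n ih => intro k; rw [hP]; exact add_nonneg (ih k) ((hπ n).1 k)
  have hPsum : ∀ n, ∑ k, P n k = n := by
    intro n
    induction n with
    | zero => simp [hP0]
    | succ n ih => rw [hP]; simp [Finset.sum_add_distrib, ih, (hπ n).2]
  -- The case d = 0 is excluded because the simplex containing p would be empty.
  have hne : Nonempty (Fin d) := by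
    by_contra h
    rw [not_nonempty_iff] at h
    simpa using hp.2
  obtain ⟨k₀, -, hk₀⟩ := Finset.exists_min_image Finset.univ u Finset.univ_nonempty
  set m := u k₀
  have hm : 0 < m := hu k₀
  have hmu : ∀ k, m ≤ u k := fun k => hk₀ k (Finset.mem_univ k)
  set U := ∑ k, u k
  have huU : ∀ k, u k ≤ U := fun k =>
    Finset.single_le_sum (f := u) (fun k _ => (hu k).le) (Finset.mem_univ k)
  have hU : 0 < U := hm.trans_le (huU k₀)
  set Q : ℕ → ℝ := fun n => P n ⬝ᵥ u
  have hQlow : ∀ n, m * n ≤ Q n := by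
    intro n
    rw [← hPsum n, Finset.mul_sum]
    refine Finset.sum_le_sum fun k _ => ?_
    rw [mul_comm]
    exact mul_le_mul_of_nonneg_left (hmu k) (hPnn n k)
  have hQup : ∀ n, Q n ≤ U * n := by
    intro n
    rw [← hPsum n, Finset.mul_sum]
    refine Finset.sum_le_sum fun k _ => ?_
    rw [mul_comm U]
    exact mul_le_mul_of_nonneg_left (huU k) (hPnn n k)
  have hQnn : ∀ n, 0 ≤ Q n := fun n => (by positivity : 0 ≤ m * n).trans (hQlow n)
  have hQmono : ∀ n, Q n ≤ Q (n + 1) := by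
    intro n
    simp only [Q, hP n, add_dotProduct]
    have : 0 ≤ proportion p (Y n) ⬝ᵥ u :=
      Finset.sum_nonneg fun k _ => mul_nonneg ((hπ n).1 k) (hu k).le
    linarith
  have hPHu : ∀ n, (P n ᵥ* H) ⬝ᵥ u = l * Q n := by
    intro n
    rw [← Matrix.dotProduct_mulVec, hHu, dotProduct_smul, smul_eq_mul]
  set A : ℕ → ℝ := fun n => ∑ j, max (Y n j) 0
  have hAnn : ∀ n, 0 ≤ A n := fun n => Finset.sum_nonneg fun _ _ => le_max_right _ _
  -- P_n H u = l Q_n ≥ l m n, of which R_n · u eventually consumes at most half; and Y_n · u ≤ U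
  -- A_n.
  set c := l * m / (2 * U)
  have hc : 0 < c := by positivity
  have hAlow : ∀ᶠ n : ℕ in atTop, c * n ≤ A n := by
    have h1 := hR.tendsto_div.eventually_lt_const (show 0 < l * m / (2 * U) by positivity)
    filter_upwards [h1, eventually_ge_atTop 1] with n h1 hn
    have hn' : (0 : ℝ) < n := by exact_mod_cast hn
    rw [div_lt_iff₀ hn'] at h1
    have h2 : Y n ⬝ᵥ u ≤ A n * U := by
      rw [Finset.sum_mul]
      refine Finset.sum_le_sum fun k _ => ?_
      calc Y n k * u k ≤ max (Y n k) 0 * u k :=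
            mul_le_mul_of_nonneg_right (le_max_left _ _) (hu k).le
        _ ≤ _ := mul_le_mul_of_nonneg_left (huU k) (le_max_right _ _)
    have h3 : Y n ⬝ᵥ u = l * Q n + R n ⬝ᵥ u := by rw [hY n, add_dotProduct, hPHu]
    have h4 := neg_le_of_abs_le (abs_dotProduct_le (R n) hu)
    have h5 : ‖R n‖ * U ≤ l * m / 2 * n := by
      calc ‖R n‖ * U ≤ (l * m / (2 * U) * n) * U := by gcongr
        _ = _ := by field_simp
    have h6 := mul_le_mul_of_nonneg_left (hQlow n) hl.le
    have h7 : c * n = (l * m / 2 * n) / U := by simp only [c]; field_simp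
    rw [h7, div_le_iff₀ hU]
    change Y n ⬝ᵥ u ≤ A n * U at h2
    change -(‖R n‖ * U) ≤ _ at h4
    linarith
  set S : ℕ → Fin d → ℝ := fun n => (fun k => max (Y n k) 0) - P n ᵥ* H
  have hS : Negligible S := by
    refine negligible_pi fun k => ?_
    obtain ⟨n₀, hn₀⟩ := eventually_atTop.mp (hAlow.and (eventually_ge_atTop 1))
    set W : ℕ → ℝ := fun n => (P n ᵥ* H) k
    have hW : ∀ n, W (n + 1) = W n + (proportion p (Y n) ᵥ* H) k := by
      intro n; simp only [W, hP n, Matrix.add_vecMul, Pi.add_apply]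
    -- The sum covers the times up to n₀, after which A is positive; ‖H‖ covers one downward jump of
    -- W.
    set b := ∑ i ∈ Finset.range (n₀ + 1), |W i| + ‖H‖
    have hb0 : ‖H‖ ≤ b :=
      le_add_of_nonneg_left (Finset.sum_nonneg fun _ _ => abs_nonneg _)
    refine hR.of_le_add 2 b zero_le_two fun r hr hRr n => ?_
    have hr0 : ∀ n, 0 ≤ r n := fun n => (norm_nonneg _).trans (hRr n)
    have hRk : ∀ n, |R n k| ≤ r n := fun n => (norm_le_pi_norm (R n) k).trans (hRr n)
    have hYk : ∀ n, Y n k = W n + R n k := fun n => by rw [hY n]; rfl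
    have hWlow : ∀ n, -(r n + b) ≤ W n := by
      intro n
      rcases le_total n n₀ with hn | hn
      · have h1 : |W n| ≤ ∑ i ∈ Finset.range (n₀ + 1), |W i| :=
          Finset.single_le_sum (f := fun i => |W i|) (fun _ _ => abs_nonneg _)
            (Finset.mem_range.mpr (by omega))
        have h2 : |W n| ≤ b := h1.trans (le_add_of_nonneg_right (norm_nonneg _))
        linarith [neg_le_of_abs_le h2, hr0 n]
      · induction n, hn using Nat.le_induction with
        | base =>
          have h1 : |W n₀| ≤ ∑ i ∈ Finset.range (n₀ + 1), |W i| :=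
            Finset.single_le_sum (f := fun i => |W i|) (fun _ _ => abs_nonneg _)
              (Finset.mem_range.mpr (by omega))
          have h2 : |W n₀| ≤ b := h1.trans (le_add_of_nonneg_right (norm_nonneg _))
          linarith [neg_le_of_abs_le h2, hr0 n₀]
        | succ n hn ih =>
          have hmono := hr (Nat.le_succ n)
          rw [hW n]
          rcases le_or_gt (Y n k) 0 with hneg | hpos
          -- Type k has proportion zero here, so the possibly negative diagonal entry of H does not
          -- enter and W cannot decrease. In the other case W n > -r n, and a single step loses at
          -- most ‖H‖.
          · have h1 : 0 ≤ (proportion p (Y n) ᵥ* H) k := by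
              change 0 ≤ ∑ q, proportion p (Y n) q * H q k
              refine Finset.sum_nonneg fun q _ => ?_
              by_cases hq : q = k
              · have h2 : A n ≠ 0 := by
                  have h3 := (hn₀ n hn).1
                  have h4 : (0 : ℝ) < n := by exact_mod_cast (hn₀ n hn).2
                  have : 0 < c * n := by positivity
                  linarith
                have h3 : proportion p (Y n) q = 0 := by
                  rw [proportion, if_neg h2, hq, max_eq_right hneg, zero_div]
                simp [h3]
              · exact mul_nonneg ((hπ n).1 q) (hoff q k hq)
            simp only [Nat.succ_eq_add_one] at hmono
            linarith
          · have h1 := neg_le_of_abs_le (abs_vecMul_le (hπ n) H k)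
            have h2 := le_of_abs_le (hRk n)
            rw [hYk n] at hpos
            simp only [Nat.succ_eq_add_one] at hmono
            linarith
    have h1 : S n k = max (Y n k) 0 - W n := rfl
    have h2 := abs_le.mp (hRk n)
    have h3 := hWlow n
    have hb1 : 0 ≤ b := (norm_nonneg _).trans hb0
    have h4 := hr0 n
    rw [h1, Real.norm_eq_abs, abs_le]
    have h5 := hYk n
    rcases max_cases (Y n k) 0 with ⟨h6, h7⟩ | ⟨h6, h7⟩ <;> rw [h6] <;> constructor <;> linarith
  have hAup : ∃ C : ℝ, 0 < C ∧ ∀ᶠ n : ℕ in atTop, A n ≤ C * n := by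
    refine ⟨d * (‖H‖ + 1), ?_, ?_⟩
    · have : 0 < d := Fin.pos k₀
      positivity
    · filter_upwards [hS.tendsto_div.eventually_lt_const one_pos, eventually_ge_atTop 1] with n h1 hn
      have hn' : (0 : ℝ) < n := by exact_mod_cast hn
      rw [div_lt_iff₀ hn'] at h1
      have h2 : ∀ k, max (Y n k) 0 ≤ (‖H‖ + 1) * n := by
        intro k
        have h3 : max (Y n k) 0 = (P n ᵥ* H) k + S n k := by simp [S]
        have h4 := le_of_abs_le (norm_le_pi_norm (S n) k)
        have h5 : (P n ᵥ* H) k ≤ n * ‖H‖ := by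
          rw [← hPsum n, Finset.sum_mul]
          change ∑ q, P n q * H q k ≤ _
          refine Finset.sum_le_sum fun q _ => mul_le_mul_of_nonneg_left ?_ (hPnn n q)
          exact (le_abs_self _).trans H.norm_entry_le_entrywise_sup_norm
        rw [h3]
        linarith
      calc A n ≤ ∑ _k : Fin d, (‖H‖ + 1) * n := Finset.sum_le_sum fun k _ => h2 k
        _ = _ := by simp; ring
  obtain ⟨C, hC, hAup⟩ := hAup
  -- This step size makes the scheme exact up to S: dividing P_{n+1} by Q_{n+1} leaves t_n x_n(H -
  -- l) plus a remainder linear in S_n. The two-sided linear bounds on A and Q make t_n of order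
  -- 1/n.
  set t : ℕ → ℝ := fun n => Q n / (A n * Q (n + 1))
  set x : ℕ → Fin d → ℝ := fun n => (Q n)⁻¹ • P n
  have hGu : (H - l • (1 : Matrix (Fin d) (Fin d) ℝ)) *ᵥ u = 0 := by
    rw [Matrix.sub_mulVec, hHu, Matrix.smul_mulVec, Matrix.one_mulVec, sub_self]
  have ht0 : ∀ n, 0 ≤ t n := fun n =>
    div_nonneg (hQnn n) (mul_nonneg (hAnn n) (hQnn (n + 1)))
  have hQpos : ∀ n : ℕ, 1 ≤ n → 0 < Q n := fun n hn => by
    have hn' : (0 : ℝ) < n := by exact_mod_cast hn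
    exact (by positivity : 0 < m * n).trans_le (hQlow n)
  have ht : Tendsto t atTop (𝓝 0) := by
    have h0 : Tendsto (fun n : ℕ => c⁻¹ * (n : ℝ)⁻¹) atTop (𝓝 0) := by
      simpa using tendsto_inv_atTop_nhds_zero_nat.const_mul c⁻¹
    refine squeeze_zero' (Eventually.of_forall ht0) ?_ h0
    filter_upwards [hAlow, eventually_ge_atTop 1] with n h1 hn
    have hn' : (0 : ℝ) < n := by exact_mod_cast hn
    have hcn : 0 < c * n := by positivity
    rw [← mul_inv, ← one_div, div_le_div_iff₀ (mul_pos (hcn.trans_le h1) (hQpos _ (by omega))) hcn]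
    rw [one_mul, mul_comm]
    exact mul_le_mul h1 (hQmono n) (hQnn n) (hAnn n)
  have hdiv : Tendsto (fun n => ∑ i ∈ Finset.range n, t i) atTop atTop := by
    refine (not_summable_iff_tendsto_nat_atTop_of_nonneg ht0).mp fun hsum => ?_
    refine Real.not_summable_one_div_natCast ?_
    refine summable_of_isBigO_nat (hsum.mul_left (2 * U * C / m)) ?_
    refine Asymptotics.IsBigO.of_bound 1 ?_
    filter_upwards [hAlow, hAup, eventually_ge_atTop 1] with n h0 h1 hn
    have hn' : (1 : ℝ) ≤ n := by exact_mod_cast hn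
    have hpos : 0 < A n := (by positivity : 0 < c * n).trans_le h0
    rw [one_mul, Real.norm_of_nonneg (by positivity), Real.norm_of_nonneg
      (mul_nonneg (by positivity) (ht0 n))]
    have h2 : Q (n + 1) ≤ 2 * U * n := by
      refine (hQup (n + 1)).trans ?_
      push_cast
      nlinarith
    have h3 := hQpos (n + 1) (by omega)
    have h4 := hQlow n
    rw [div_mul_div_comm, div_le_div_iff₀ (by positivity) (by positivity), one_mul]
    calc m * (A n * Q (n + 1)) ≤ m * ((C * n) * (2 * U * n)) := by gcongr
      _ = 2 * U * C * (m * n) * n := by ring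
      _ ≤ _ := by gcongr
  have hsx : Summable fun n =>
      ‖x (n + 1) - x n - t n • (x n ᵥ* (H - l • (1 : Matrix (Fin d) (Fin d) ℝ)))‖ := by
    refine summable_of_isBigO_nat (hS.summable.mul_left ((1 + U / m) / (c * m))) ?_
    refine Asymptotics.IsBigO.of_bound 1 ?_
    filter_upwards [hAlow, eventually_ge_atTop 1] with n h0 hn
    have hn' : (1 : ℝ) ≤ n := by exact_mod_cast hn
    have hpos : 0 < A n := (by positivity : 0 < c * n).trans_le h0
    have hQ := hQpos n hn
    have hQ' := hQpos (n + 1) (by omega)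
    have hstep : ∀ k, P (n + 1) k = P n k + ((P n ᵥ* H) k + S n k) / A n := by
      intro k
      rw [hP n, Pi.add_apply, proportion, if_neg hpos.ne']
      simp [S, A]
    have hQstep : Q (n + 1) = Q n + (l * Q n + S n ⬝ᵥ u) / A n := by
      rw [← hPHu n, ← add_dotProduct]
      simp only [Q, dotProduct, Finset.sum_div, ← Finset.sum_add_distrib]
      refine Finset.sum_congr rfl fun k _ => ?_
      rw [hstep k, Pi.add_apply]
      ring
    rw [one_mul, norm_norm, Real.norm_of_nonneg (by positivity)]
    refine (pi_norm_le_iff_of_nonneg (by positivity)).mpr fun k => ?_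
    -- The denominator is at least of order n² and P_n/Q_n is bounded, so the remainder is
    -- O(‖S_n‖/n²), summable by negligibility.
    have heq : (x (n + 1) - x n - t n • (x n ᵥ* (H - l • (1 : Matrix (Fin d) (Fin d) ℝ)))) k =
        (S n k - (S n ⬝ᵥ u) * (P n k / Q n)) / (A n * Q (n + 1)) := by
      have h1 : (x n ᵥ* (H - l • (1 : Matrix (Fin d) (Fin d) ℝ))) k =
          ((P n ᵥ* H) k - l * P n k) / Q n := by
        rw [Matrix.vecMul_sub, Matrix.vecMul_smul, Matrix.vecMul_one]
        simp only [x, Matrix.smul_vecMul, Pi.sub_apply, Pi.smul_apply, smul_eq_mul]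
        ring
      simp only [Pi.sub_apply, Pi.smul_apply, smul_eq_mul, h1]
      simp only [x, t, Pi.smul_apply, smul_eq_mul, hstep k]
      have h2 : A n * Q (n + 1) = A n * Q n + (l * Q n + S n ⬝ᵥ u) := by
        rw [hQstep]; field_simp
      have h3 : S n ⬝ᵥ u = A n * Q (n + 1) - A n * Q n - l * Q n := by linarith
      rw [h3]
      field_simp
      ring
    have hratio : P n k / Q n ≤ 1 / m := by
      rw [div_le_div_iff₀ hQ hm, one_mul]
      calc P n k * m ≤ P n k * u k := mul_le_mul_of_nonneg_left (hmu k) (hPnn n k)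
        _ ≤ Q n := Finset.single_le_sum (f := fun k => P n k * u k)
            (fun k _ => mul_nonneg (hPnn n k) (hu k).le) (Finset.mem_univ k)
    have hnum : |S n k - (S n ⬝ᵥ u) * (P n k / Q n)| ≤ (1 + U / m) * ‖S n‖ := by
      calc _ ≤ |S n k| + |(S n ⬝ᵥ u) * (P n k / Q n)| := abs_sub _ _
        _ ≤ ‖S n‖ + (‖S n‖ * U) * (1 / m) := by
          rw [abs_mul, abs_of_nonneg (div_nonneg (hPnn n k) hQ.le)]
          refine add_le_add (norm_le_pi_norm (S n) k) ?_
          exact mul_le_mul (abs_dotProduct_le (S n) hu) hratio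
            (div_nonneg (hPnn n k) hQ.le) (by positivity)
        _ = _ := by ring
    rw [heq, Real.norm_eq_abs, abs_div, abs_of_pos (mul_pos hpos hQ')]
    have hden : c * m * (n : ℝ) ^ 2 ≤ A n * Q (n + 1) := by
      calc c * m * (n : ℝ) ^ 2 = (c * n) * (m * n) := by ring
        _ ≤ _ := mul_le_mul h0 ((hQlow n).trans (hQmono n)) (by positivity) hpos.le
    calc _ ≤ (1 + U / m) * ‖S n‖ / (c * m * (n : ℝ) ^ 2) := by gcongr
      _ = _ := by rw [div_mul_div_comm]
  obtain ⟨y, hxy, hyG⟩ := tendsto_of_perturbed_generator (u := u) (fun q k hqk => by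
    simpa [Matrix.one_apply_ne hqk] using hoff q k hqk) hu hGu ht0 ht hdiv hsx
  have hxnn : ∀ n k, 0 ≤ x n k := fun n k => mul_nonneg (inv_nonneg.mpr (hQnn n)) (hPnn n k)
  have hxsum : ∀ n, ∑ k, x n k = n / Q n := by
    intro n
    simp only [x, Pi.smul_apply, smul_eq_mul, ← Finset.mul_sum, hPsum]
    ring
  have hsumlim : Tendsto (fun n => ∑ k, x n k) atTop (𝓝 (∑ k, y k)) :=
    tendsto_finsetSum _ fun k _ => (tendsto_pi_nhds.mp hxy) k
  -- The limit is nonzero because the coordinates of x_n sum to n/Q_n ≥ 1/U; it can therefore be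
  -- rescaled to a probability vector.
  have hypos : 0 < ∑ k, y k := by
    refine (one_div_pos.mpr hU).trans_le (ge_of_tendsto hsumlim ?_)
    filter_upwards [eventually_ge_atTop 1] with n hn
    rw [hxsum, div_le_div_iff₀ hU (hQpos n hn), one_mul, mul_comm]
    exact hQup n
  have hynn : ∀ k, 0 ≤ y k := fun k =>
    ge_of_tendsto' ((tendsto_pi_nhds.mp hxy) k) fun n => hxnn n k
  refine ⟨(∑ k, y k)⁻¹ • y, ⟨fun k => mul_nonneg (inv_nonneg.mpr hypos.le) (hynn k), ?_⟩, ?_, ?_⟩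
  · simp only [Pi.smul_apply, smul_eq_mul, ← Finset.mul_sum]
    exact inv_mul_cancel₀ hypos.ne'
  · rw [Matrix.vecMul_sub, Matrix.vecMul_smul, Matrix.vecMul_one, sub_eq_zero] at hyG
    rw [Matrix.smul_vecMul, hyG, smul_comm]
  · refine ((hsumlim.inv₀ hypos.ne').smul hxy).congr' ?_
    filter_upwards [eventually_ge_atTop 1] with n hn
    have hQ := hQpos n hn
    rw [hxsum]
    simp only [x, smul_smul]
    congr 1
    field_simp

end Drift

/-! ### Logarithmic weights -/

section LogWeights

/-- The shift 8 > e² makes the logarithm grow by a factor of at most 1 + 1/(2(n+2)) per step, slow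
enough for the difference estimate below. -/
theorem two_le_log_add_eight (n : ℕ) : 2 ≤ Real.log ((n : ℝ) + 8) := by
  have hn : (0 : ℝ) ≤ n := Nat.cast_nonneg n
  rw [Real.le_log_iff_exp_le (by positivity)]
  have h1 : Real.exp 2 = Real.exp 1 ^ 2 := by rw [← Real.exp_nat_mul]; norm_num
  have h2 := Real.exp_one_lt_d9
  have h3 := Real.exp_pos 1
  rw [h1]
  nlinarith

/-- The logarithmic weights `log (n + 8) ^ (1 + δ)`. -/
noncomputable def logWeight (δ : ℝ) (n : ℕ) : ℝ := Real.log ((n : ℝ) + 8) ^ (1 + δ)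

theorem logWeight_pos (δ : ℝ) (n : ℕ) : 0 < logWeight δ n :=
  Real.rpow_pos_of_pos (zero_lt_two.trans_le (two_le_log_add_eight n)) _

theorem logWeight_succ_le {δ : ℝ} (h0 : 0 ≤ δ) (h1 : δ ≤ 1) (n : ℕ) :
    logWeight δ (n + 1) ≤ logWeight δ n * (1 + 1 / (2 * ((n : ℝ) + 2))) ^ 2 := by
  have hn : (0 : ℝ) ≤ n := Nat.cast_nonneg n
  have h2 := two_le_log_add_eight n
  set q : ℝ := 1 + 1 / (2 * ((n : ℝ) + 2))
  have hq : 1 ≤ q := le_add_of_nonneg_right (by positivity)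
  have hlog : Real.log (((n + 1 : ℕ) : ℝ) + 8) ≤ Real.log ((n : ℝ) + 8) * q := by
    have h3 : ((n + 1 : ℕ) : ℝ) + 8 = ((n : ℝ) + 8) * (1 + 1 / ((n : ℝ) + 8)) := by
      push_cast; field_simp; ring
    rw [h3, Real.log_mul (by positivity) (by positivity)]
    have h4 : Real.log (1 + 1 / ((n : ℝ) + 8)) ≤ 1 / ((n : ℝ) + 8) := by
      have := Real.log_le_sub_one_of_pos (show 0 < 1 + 1 / ((n : ℝ) + 8) by positivity)
      linarith
    have h5 : 1 / ((n : ℝ) + 8) ≤ Real.log ((n : ℝ) + 8) * (1 / (2 * ((n : ℝ) + 2))) := by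
      calc 1 / ((n : ℝ) + 8) ≤ 2 * (1 / (2 * ((n : ℝ) + 2))) := by
            rw [mul_one_div, div_le_div_iff₀ (by positivity) (by positivity)]; linarith
        _ ≤ _ := by gcongr
    rw [show Real.log ((n : ℝ) + 8) * q = Real.log ((n : ℝ) + 8) +
      Real.log ((n : ℝ) + 8) * (1 / (2 * ((n : ℝ) + 2))) by ring]
    linarith
  calc logWeight δ (n + 1) ≤ (Real.log ((n : ℝ) + 8) * q) ^ (1 + δ) :=
        Real.rpow_le_rpow ((two_le_log_add_eight (n + 1)).trans' zero_le_two) hlog (by linarith)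
    _ = logWeight δ n * q ^ (1 + δ) := by
        rw [Real.mul_rpow (by linarith) (by linarith)]; rfl
    _ ≤ logWeight δ n * q ^ 2 := by
        refine mul_le_mul_of_nonneg_left ?_ (logWeight_pos δ n).le
        rw [← Real.rpow_natCast q 2]
        exact Real.rpow_le_rpow_of_exponent_le hq (by push_cast; linarith)

/-- This supplies the weights for summation by parts: v_n = L_n/(n+1)³ against differences of h_n =
L_n/(n+1)². After clearing denominators, a polynomial with nonnegative coefficients remains. -/
theorem logWeight_div_cube_le {δ : ℝ} (h0 : 0 ≤ δ) (h1 : δ ≤ 1) (n : ℕ) :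
    logWeight δ n / ((n : ℝ) + 1) ^ 3 ≤ 4 * (logWeight δ n / ((n : ℝ) + 1) ^ 2 -
      logWeight δ (n + 1) / (((n + 1 : ℕ) : ℝ) + 1) ^ 2) := by
  have hn : (0 : ℝ) ≤ n := Nat.cast_nonneg n
  have hL := logWeight_pos δ n
  have h2 : logWeight δ (n + 1) / (((n + 1 : ℕ) : ℝ) + 1) ^ 2 ≤
      logWeight δ n * ((1 + 1 / (2 * ((n : ℝ) + 2))) ^ 2 / ((n : ℝ) + 2) ^ 2) := by
    rw [mul_div_assoc']
    have h3 : ((n + 1 : ℕ) : ℝ) + 1 = (n : ℝ) + 2 := by push_cast; ring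
    rw [h3]
    gcongr
    exact logWeight_succ_le h0 h1 n
  have h3 : 1 / ((n : ℝ) + 1) ^ 3 ≤ 4 * (1 / ((n : ℝ) + 1) ^ 2 -
      (1 + 1 / (2 * ((n : ℝ) + 2))) ^ 2 / ((n : ℝ) + 2) ^ 2) := by
    have h4 : 4 * (1 / ((n : ℝ) + 1) ^ 2 - (1 + 1 / (2 * ((n : ℝ) + 2))) ^ 2 / ((n : ℝ) + 2) ^ 2) -
        1 / ((n : ℝ) + 1) ^ 3 = (4 * ((n : ℝ) + 1) * ((n : ℝ) + 2) ^ 4 -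
          ((n : ℝ) + 2) ^ 4 - ((n : ℝ) + 1) ^ 3 * (2 * n + 5) ^ 2) /
          (((n : ℝ) + 1) ^ 3 * ((n : ℝ) + 2) ^ 4) := by
      field_simp
      ring
    have h5 : 0 ≤ 4 * ((n : ℝ) + 1) * ((n : ℝ) + 2) ^ 4 -
          ((n : ℝ) + 2) ^ 4 - ((n : ℝ) + 1) ^ 3 * (2 * n + 5) ^ 2 := by
      ring_nf; positivity
    have : 0 ≤ 4 * (1 / ((n : ℝ) + 1) ^ 2 -
        (1 + 1 / (2 * ((n : ℝ) + 2))) ^ 2 / ((n : ℝ) + 2) ^ 2) - 1 / ((n : ℝ) + 1) ^ 3 := by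
      rw [h4]; positivity
    linarith
  have h4 := mul_le_mul_of_nonneg_left h3 hL.le
  rw [mul_one_div] at h4
  have h5 : logWeight δ n * (4 * (1 / ((n : ℝ) + 1) ^ 2 -
      (1 + 1 / (2 * ((n : ℝ) + 2))) ^ 2 / ((n : ℝ) + 2) ^ 2)) =
      4 * (logWeight δ n / ((n : ℝ) + 1) ^ 2 -
        logWeight δ n * ((1 + 1 / (2 * ((n : ℝ) + 2))) ^ 2 / ((n : ℝ) + 2) ^ 2)) := by ring
  linarith

theorem summable_inv_logWeight {δ : ℝ} (h0 : 0 < δ) :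
    Summable fun n : ℕ => 1 / (((n : ℝ) + 1) * logWeight δ n) := by
  refine (summable_condensed_iff_of_nonneg (fun n => ?_) fun m n _ hmn => ?_).mp ?_
  · have := logWeight_pos δ n
    positivity
  · have := logWeight_pos δ m
    have h1 := two_le_log_add_eight m
    have hmn' : (m : ℝ) ≤ n := by exact_mod_cast hmn
    have h2 : logWeight δ m ≤ logWeight δ n := by
      unfold logWeight
      gcongr
    gcongr
  · have hs := (Real.summable_one_div_nat_rpow.mpr (show 1 < 1 + δ by linarith)).mul_left
      (1 / Real.log 2 ^ (1 + δ))
    refine summable_of_isBigO_nat hs (Asymptotics.IsBigO.of_bound 1 ?_)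
    filter_upwards [eventually_ge_atTop 1] with k hk
    have hk' : (0 : ℝ) < k := by exact_mod_cast hk
    have hL := logWeight_pos δ (2 ^ k)
    have hlog2 := Real.log_pos one_lt_two
    rw [one_mul, Real.norm_of_nonneg (by positivity), Real.norm_of_nonneg (by positivity)]
    have h1 : (Real.log 2 * k) ^ (1 + δ) ≤ logWeight δ (2 ^ k) := by
      unfold logWeight
      refine Real.rpow_le_rpow (by positivity) ?_ (by linarith)
      rw [mul_comm, ← Real.log_pow]
      refine Real.log_le_log (by positivity) ?_
      push_cast
      linarith
    rw [Real.mul_rpow hlog2.le hk'.le] at h1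
    calc (2 : ℝ) ^ k * (1 / ((((2 ^ k : ℕ) : ℝ) + 1) * logWeight δ (2 ^ k))) ≤
        1 / logWeight δ (2 ^ k) := by
          push_cast
          rw [mul_one_div, div_le_div_iff₀ (by positivity) hL]
          linarith
      _ ≤ 1 / (Real.log 2 ^ (1 + δ) * (k : ℝ) ^ (1 + δ)) := by gcongr
      _ = 1 / Real.log 2 ^ (1 + δ) * (1 / (k : ℝ) ^ (1 + δ)) := by
          rw [div_mul_div_comm, one_mul]

theorem logWeight_le {δ ε : ℝ} (h0 : 0 ≤ δ) (hδ : δ ≤ ε) {n : ℕ} (hn : 1 ≤ n) :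
    logWeight δ n ≤ 4 ^ (1 + ε) * Real.log ((n : ℝ) + 1) ^ (1 + ε) := by
  have hn' : (1 : ℝ) ≤ n := by exact_mod_cast hn
  have h2 := two_le_log_add_eight n
  rw [← Real.mul_rpow (by norm_num) (Real.log_nonneg (by linarith))]
  calc logWeight δ n ≤ Real.log ((n : ℝ) + 8) ^ (1 + ε) :=
        Real.rpow_le_rpow_of_exponent_le (by linarith) (by linarith)
    _ ≤ _ := by
        refine Real.rpow_le_rpow (by linarith) ?_ (by linarith)
        have h3 : (4 : ℝ) * Real.log ((n : ℝ) + 1) = Real.log (((n : ℝ) + 1) ^ 4) := by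
          rw [Real.log_pow]; norm_num
        rw [h3]
        refine Real.log_le_log (by positivity) ?_
        nlinarith [pow_le_pow_left₀ zero_le_one hn' 2, pow_le_pow_left₀ zero_le_one hn' 3,
          pow_le_pow_left₀ zero_le_one hn' 4]

end LogWeights

/-! ### Pathwise maximal inequality and passage from squares to first powers -/

section Pathwise

/-- A pathwise form of Doob's `L²` maximal inequality. -/
theorem sq_partialSups_le (ξ : ℕ → ℝ) (n : ℕ) :
    partialSups (fun k => |∑ i ∈ Finset.range k, ξ i|) n ^ 2 ≤
      4 * ∑ k ∈ Finset.range n, ξ k ^ 2 + ∑ k ∈ Finset.range n,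
        (8 * ∑ i ∈ Finset.range k, ξ i - 4 * partialSups (fun k => |∑ i ∈ Finset.range k, ξ i|) k *
          Real.sign (∑ i ∈ Finset.range k, ξ i)) * ξ k := by
  set M : ℕ → ℝ := fun k => ∑ i ∈ Finset.range k, ξ i with hM
  set m : ℕ → ℝ := fun n => partialSups (fun k => |∑ i ∈ Finset.range k, ξ i|) n
  have hMs : ∀ n, M (n + 1) = M n + ξ n := fun n => Finset.sum_range_succ _ _
  have hms : ∀ n, m (n + 1) = max (m n) |M (n + 1)| := fun n => partialSups_add_one _ _
  have hMm : ∀ n, |M n| ≤ m n := fun n => le_partialSups (fun k => |M k|) n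
  -- Discrete version of ∫ m d|M| = m|M| - ∫ |M| dm, in which m grows only at times when |M| = m.
  -- Combined with (m - 2|M|)² ≥ 0 it gives the factor 4.
  have hI : ∀ n, ∑ k ∈ Finset.range n, m k * Real.sign (M k) * ξ k ≤
      m n * |M n| - m n ^ 2 / 2 := by
    intro n
    induction n with
    | zero => simp [m, M]
    | succ n ih =>
      rw [Finset.sum_range_succ]
      have h0 : 0 ≤ m n := (abs_nonneg _).trans (hMm n)
      have h1 : |M n| + Real.sign (M n) * ξ n ≤ |M (n + 1)| := by
        rw [hMs]
        rcases lt_trichotomy (M n) 0 with h | h | h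
        · rw [Real.sign_of_neg h, abs_of_neg h]
          linarith [neg_abs_le (M n + ξ n)]
        · simp [h]
        · rw [Real.sign_of_pos h, abs_of_pos h]
          linarith [le_abs_self (M n + ξ n)]
      have h2 := mul_le_mul_of_nonneg_left h1 h0
      rcases max_cases (m n) |M (n + 1)| with ⟨h3, h4⟩ | ⟨h3, h4⟩
      · rw [hms, h3]; nlinarith
      · rw [hms, h3]; nlinarith [sq_nonneg (m n - |M (n + 1)|)]
  have hsq : ∀ n, M n ^ 2 = ∑ k ∈ Finset.range n, (2 * M k * ξ k + ξ k ^ 2) := by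
    intro n
    induction n with
    | zero => simp [M]
    | succ n ih => rw [Finset.sum_range_succ, ← ih, hMs]; ring
  have h1 := hI n
  have h2 : m n ^ 2 ≤ 4 * M n ^ 2 - 4 * ∑ k ∈ Finset.range n, m k * Real.sign (M k) * ξ k := by
    nlinarith [sq_nonneg (m n - 2 * |M n|), sq_abs (M n)]
  refine h2.trans_eq ?_
  rw [hsq, Finset.mul_sum, Finset.mul_sum, Finset.mul_sum, ← Finset.sum_sub_distrib,
    ← Finset.sum_add_distrib]
  exact Finset.sum_congr rfl fun k _ => by ring

/-- By the arithmetic-geometric mean inequality, x/n² ≤ 1/(nL) + Lx²/n³. The first series converges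
thanks to the exponent 1 + δ > 1; this is where the logarithm is spent. -/
theorem negligible_of_summable_sq {s : ℕ → ℝ} {δ : ℝ} (h0 : 0 < δ)
    (h : Summable fun m : ℕ => logWeight δ m / ((m : ℝ) + 1) ^ 3 *
      partialSups (fun k => |s k|) (m + 1) ^ 2) : Negligible s := by
  refine ⟨partialSups fun k => |s k|, (partialSups _).monotone,
    fun n => le_partialSups (fun k => |s k|) n, ?_⟩
  have hnn : ∀ n, 0 ≤ partialSups (fun k => |s k|) n := fun n =>
    (abs_nonneg _).trans (le_partialSups (fun k => |s k|) n)
  refine Summable.of_nonneg_of_le (fun m => div_nonneg (hnn _) (by positivity)) (fun m => ?_)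
    ((summable_inv_logWeight h0).add h)
  set x := partialSups (fun k => |s k|) (m + 1)
  have hL := logWeight_pos δ m
  have hx := hnn (m + 1)
  have h1 : 1 / (((m : ℝ) + 1) * logWeight δ m) + logWeight δ m / ((m : ℝ) + 1) ^ 3 * x ^ 2 -
      x / ((m : ℝ) + 1) ^ 2 = (((m : ℝ) + 1) ^ 2 + (logWeight δ m * x) ^ 2 -
        logWeight δ m * x * ((m : ℝ) + 1)) / (((m : ℝ) + 1) ^ 3 * logWeight δ m) := by
    field_simp
  have h2 : 0 ≤ ((m : ℝ) + 1) ^ 2 + (logWeight δ m * x) ^ 2 -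
        logWeight δ m * x * ((m : ℝ) + 1) := by
    nlinarith [sq_nonneg (((m : ℝ) + 1) - logWeight δ m * x), sq_nonneg ((m : ℝ) + 1),
      sq_nonneg (logWeight δ m * x)]
  have h3 : 0 ≤ 1 / (((m : ℝ) + 1) * logWeight δ m) + logWeight δ m / ((m : ℝ) + 1) ^ 3 * x ^ 2 -
      x / ((m : ℝ) + 1) ^ 2 := by
    rw [h1]; positivity
  linarith

end Pathwise

/-! ### Localized L² estimates for martingale differences -/

section Martingale

variable {Ω : Type*} {m0 : MeasurableSpace Ω} {μ : Measure Ω}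
  {ℱ : Filtration ℕ m0}

theorem ae_summable_of_sum_integral_le {f : ℕ → Ω → ℝ} (hf : ∀ n, Integrable (f n) μ)
    (h0 : ∀ n, 0 ≤ᵐ[μ] f n) {C : ℝ} (hC : ∀ N, ∑ n ∈ Finset.range N, ∫ ω, f n ω ∂μ ≤ C) :
    ∀ᵐ ω ∂μ, Summable fun n => f n ω := by
  have hint : ∀ n, 0 ≤ ∫ ω, f n ω ∂μ := fun n => integral_nonneg_of_ae (h0 n)
  have h1 : ∫⁻ ω, ∑' n, ENNReal.ofReal (f n ω) ∂μ ≠ ⊤ := by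
    rw [lintegral_tsum fun n => (hf n).aestronglyMeasurable.aemeasurable.ennreal_ofReal]
    have h2 : ∀ n, ∫⁻ ω, ENNReal.ofReal (f n ω) ∂μ = ENNReal.ofReal (∫ ω, f n ω ∂μ) :=
      fun n => (ofReal_integral_eq_lintegral_ofReal (hf n) (h0 n)).symm
    simp only [h2]
    exact (summable_of_sum_range_le hint hC).tsum_ofReal_ne_top
  have h2 := ae_lt_top' (AEMeasurable.tsum fun n =>
    (hf n).aestronglyMeasurable.aemeasurable.ennreal_ofReal) h1
  filter_upwards [h2, ae_all_iff.mpr h0] with ω h2 h3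
  refine (ENNReal.summable_toReal h2.ne).congr fun n => ?_
  exact ENNReal.toReal_ofReal (h3 n)

theorem integral_mul_condExp [IsProbabilityMeasure μ] {m : MeasurableSpace Ω} (hm : m ≤ m0) {c f : Ω → ℝ}
    (hc : StronglyMeasurable[m] c) (hcf : Integrable (c * f) μ) (hf : Integrable f μ) :
    ∫ ω, c ω * f ω ∂μ = ∫ ω, c ω * (μ[f | m]) ω ∂μ := by
  have h1 := condExp_mul_of_stronglyMeasurable_left hc hcf hf
  calc ∫ ω, c ω * f ω ∂μ = ∫ ω, (μ[c * f | m]) ω ∂μ := (integral_condExp hm).symm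
    _ = _ := integral_congr_ae h1

/-- The indicator that the running sum of `a` has not exceeded `K` yet. -/
noncomputable def below (a : ℕ → Ω → ℝ) (K : ℝ) (n : ℕ) (ω : Ω) : ℝ :=
  {ω | ∑ i ∈ Finset.range (n + 1), a i ω ≤ K}.indicator (fun _ => 1) ω

theorem below_eq_zero_or_one (a : ℕ → Ω → ℝ) (K : ℝ) (n : ℕ) (ω : Ω) :
    below a K n ω = 0 ∨ below a K n ω = 1 := by
  by_cases h : ω ∈ {ω | ∑ i ∈ Finset.range (n + 1), a i ω ≤ K}
  · right; simp only [below, Set.indicator_of_mem h]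
  · left; simp only [below, Set.indicator_of_notMem h]

theorem norm_below_le (a : ℕ → Ω → ℝ) (K : ℝ) (n : ℕ) (ω : Ω) : ‖below a K n ω‖ ≤ 1 := by
  rcases below_eq_zero_or_one a K n ω with h | h <;> simp [h]

theorem below_nonneg (a : ℕ → Ω → ℝ) (K : ℝ) (n : ℕ) (ω : Ω) : 0 ≤ below a K n ω := by
  rcases below_eq_zero_or_one a K n ω with h | h <;> simp [h]

theorem stronglyMeasurable_below {a : ℕ → Ω → ℝ} (ha : ∀ n, StronglyMeasurable[ℱ n] (a n))
    (K : ℝ) (n : ℕ) : StronglyMeasurable[ℱ n] (below a K n) := by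
  refine StronglyMeasurable.indicator stronglyMeasurable_const ?_
  have h1 : Measurable[ℱ n] fun ω => ∑ i ∈ Finset.range (n + 1), a i ω :=
    Finset.measurable_sum _ fun i hi =>
      ((ha i).mono (ℱ.mono (by simp at hi; omega))).measurable
  exact measurableSet_le h1 measurable_const

/-- The indicator at n already includes `a n`, so the stopped sum does not overshoot K. It stays
predictable because `a n`, a conditional expectation, is known at time n. -/
theorem sum_below_mul_le {a : ℕ → Ω → ℝ} (ha : ∀ n ω, 0 ≤ a n ω) {K : ℝ} (hK : 0 ≤ K) (N : ℕ)
    (ω : Ω) : ∑ n ∈ Finset.range N, below a K n ω * a n ω ≤ K := by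
  induction N with
  | zero => simpa
  | succ N ih =>
    by_cases h : ω ∈ {ω | ∑ i ∈ Finset.range (N + 1), a i ω ≤ K}
    · refine (Finset.sum_le_sum fun n _ => ?_).trans h
      have := (le_abs_self _).trans (norm_below_le a K n ω)
      exact mul_le_of_le_one_left (ha n ω) this
    · rw [Finset.sum_range_succ]
      have : below a K N ω = 0 := by simp only [below, Set.indicator_of_notMem h]
      simpa [this] using ih

theorem exists_below_eq_one {a : ℕ → Ω → ℝ} (ha : ∀ n ω, 0 ≤ a n ω) {ω : Ω}
    (h : Summable fun n => a n ω) : ∃ K : ℕ, ∀ n, below a K n ω = 1 := by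
  obtain ⟨K, hK⟩ := exists_nat_ge (∑' n, a n ω)
  refine ⟨K, fun n => ?_⟩
  have : ω ∈ {ω | ∑ i ∈ Finset.range (n + 1), a i ω ≤ K} :=
    (h.sum_le_tsum _ fun i _ => ha i ω).trans hK
  simp only [below, Set.indicator_of_mem this]

theorem integrable_below_mul {a : ℕ → Ω → ℝ} (ha : ∀ n, StronglyMeasurable[ℱ n] (a n)) (K : ℝ)
    (n : ℕ) {f : Ω → ℝ} (hf : Integrable f μ) : Integrable (below a K n * f) μ :=
  hf.bdd_mul ((stronglyMeasurable_below ha K n).mono (ℱ.le n)).aestronglyMeasurable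
    (Eventually.of_forall (norm_below_le a K n))

theorem sum_integral_below_mul_le [IsProbabilityMeasure μ] {g : ℕ → Ω → ℝ} (hg : ∀ n, Integrable (g n) μ) {K : ℝ}
    (hK : 0 ≤ K) (N : ℕ) :
    ∑ n ∈ Finset.range N, ∫ ω, below (fun n ω => |(μ[g n | ℱ n]) ω|) K n ω * g n ω ∂μ ≤ K := by
  set a : ℕ → Ω → ℝ := fun n ω => |(μ[g n | ℱ n]) ω|
  have ha : ∀ n, StronglyMeasurable[ℱ n] (a n) := fun n =>
    continuous_abs.comp_stronglyMeasurable stronglyMeasurable_condExp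
  have hint : ∀ n, Integrable (fun ω => below a K n ω * a n ω) μ := fun n =>
    integrable_below_mul ha K n integrable_condExp.abs
  calc ∑ n ∈ Finset.range N, ∫ ω, below a K n ω * g n ω ∂μ
      ≤ ∑ n ∈ Finset.range N, ∫ ω, below a K n ω * a n ω ∂μ := by
        refine Finset.sum_le_sum fun n _ => ?_
        rw [integral_mul_condExp (ℱ.le n) (stronglyMeasurable_below ha K n)
          (integrable_below_mul ha K n (hg n)) (hg n)]
        refine integral_mono (integrable_below_mul ha K n integrable_condExp) (hint n) fun ω => ?_
        exact mul_le_mul_of_nonneg_left (le_abs_self _) (below_nonneg a K n ω)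
    _ = ∫ ω, ∑ n ∈ Finset.range N, below a K n ω * a n ω ∂μ :=
        (integral_finsetSum _ fun n _ => hint n).symm
    _ ≤ ∫ _, K ∂μ := integral_mono (integrable_finsetSum _ fun n _ => hint n)
        (integrable_const K) fun ω => sum_below_mul_le (fun _ _ => abs_nonneg _) hK N ω
    _ = K := by simp

/-- If the conditional means of nonnegative variables are summable, so are the variables. -/
theorem ae_summable_of_condExp [IsProbabilityMeasure μ] {g : ℕ → Ω → ℝ} (hg : ∀ n, Integrable (g n) μ)
    (hg0 : ∀ n, 0 ≤ᵐ[μ] g n) (h : ∀ᵐ ω ∂μ, Summable fun n => (μ[g n | ℱ n]) ω) :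
    ∀ᵐ ω ∂μ, Summable fun n => g n ω := by
  set a : ℕ → Ω → ℝ := fun n ω => |(μ[g n | ℱ n]) ω|
  have ha : ∀ n, StronglyMeasurable[ℱ n] (a n) := fun n =>
    continuous_abs.comp_stronglyMeasurable stronglyMeasurable_condExp
  have h1 : ∀ K : ℕ, ∀ᵐ ω ∂μ, Summable fun n => below a K n ω * g n ω := fun K =>
    ae_summable_of_sum_integral_le (fun n => integrable_below_mul ha K n (hg n))
      (fun n => (hg0 n).mono fun ω hω => mul_nonneg (below_nonneg a K n ω) hω)
      fun N => sum_integral_below_mul_le hg K.cast_nonneg N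
  filter_upwards [h, ae_all_iff.mpr h1] with ω h h1
  obtain ⟨K, hK⟩ := exists_below_eq_one (a := a) (fun _ _ => abs_nonneg _) h.abs
  simpa [hK] using h1 K

variable {ξ : ℕ → Ω → ℝ}

theorem stronglyMeasurable_sum_range (hξ : ∀ n, StronglyMeasurable[ℱ (n + 1)] (ξ n)) (n : ℕ) :
    StronglyMeasurable[ℱ n] fun ω => ∑ i ∈ Finset.range n, ξ i ω :=
  Finset.stronglyMeasurable_fun_sum _ fun i hi =>
    (hξ i).mono (ℱ.mono (by simp at hi; omega))

theorem stronglyMeasurable_partialSups (hξ : ∀ n, StronglyMeasurable[ℱ (n + 1)] (ξ n)) (n : ℕ) :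
    StronglyMeasurable[ℱ n] fun ω =>
      partialSups (fun k => |∑ i ∈ Finset.range k, ξ i ω|) n := by
  induction n with
  | zero => simpa using stronglyMeasurable_const
  | succ n ih =>
    simp only [partialSups_add_one]
    exact continuous_sup.comp_stronglyMeasurable ((ih.mono (ℱ.mono n.le_succ)).prodMk
      (continuous_abs.comp_stronglyMeasurable (stronglyMeasurable_sum_range hξ (n + 1))))

theorem partialSups_le_sum (x : ℕ → ℝ) (n : ℕ) :
    partialSups (fun k => |∑ i ∈ Finset.range k, x i|) n ≤ ∑ i ∈ Finset.range n, |x i| := by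
  refine partialSups_le _ _ _ fun j hj => (Finset.abs_sum_le_sum_abs _ _).trans ?_
  exact Finset.sum_le_sum_of_subset_of_nonneg (by simpa using hj) fun _ _ _ => abs_nonneg _

theorem memLp_partialSups (hξ : ∀ n, StronglyMeasurable[ℱ (n + 1)] (ξ n))
    (hL : ∀ n, MemLp (ξ n) 2 μ) (n : ℕ) :
    MemLp (fun ω => partialSups (fun k => |∑ i ∈ Finset.range k, ξ i ω|) n) 2 μ := by
  refine (memLp_finsetSum (Finset.range n) fun i _ => (hL i).norm).mono
    ((stronglyMeasurable_partialSups hξ n).mono (ℱ.le n)).aestronglyMeasurable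
    (Eventually.of_forall fun ω => ?_)
  have h0 : 0 ≤ partialSups (fun k => |∑ i ∈ Finset.range k, ξ i ω|) n :=
    (abs_nonneg _).trans (le_partialSups (fun k => |∑ i ∈ Finset.range k, ξ i ω|) n)
  rw [Real.norm_of_nonneg h0]
  exact (partialSups_le_sum _ n).trans (le_abs_self _)

/-- Doob's `L²` maximal inequality for martingale differences `ξ`. -/
theorem integral_sq_partialSups_le [IsProbabilityMeasure μ] (hξ : ∀ n, StronglyMeasurable[ℱ (n + 1)] (ξ n))
    (hL : ∀ n, MemLp (ξ n) 2 μ) (hc : ∀ n, μ[ξ n | ℱ n] =ᵐ[μ] 0) (n : ℕ) :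
    ∫ ω, partialSups (fun k => |∑ i ∈ Finset.range k, ξ i ω|) n ^ 2 ∂μ ≤
      4 * ∑ k ∈ Finset.range n, ∫ ω, ξ k ω ^ 2 ∂μ := by
  set c : ℕ → Ω → ℝ := fun k ω => 8 * ∑ i ∈ Finset.range k, ξ i ω -
    4 * partialSups (fun k => |∑ i ∈ Finset.range k, ξ i ω|) k *
      Real.sign (∑ i ∈ Finset.range k, ξ i ω)
  have hsign : Measurable Real.sign := by
    unfold Real.sign
    exact Measurable.ite measurableSet_Iio measurable_const
      (Measurable.ite measurableSet_Ioi measurable_const measurable_const)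
  have hcm : ∀ k, StronglyMeasurable[ℱ k] (c k) := fun k =>
    (((stronglyMeasurable_sum_range hξ k).const_mul 8).sub
      (((stronglyMeasurable_partialSups hξ k).const_mul 4).mul
        (hsign.comp (stronglyMeasurable_sum_range hξ k).measurable).stronglyMeasurable))
  have hcL : ∀ k, MemLp (c k) 2 μ := by
    intro k
    -- Here 12 = 8 + 4: the partial sum and its running maximum are both at most ∑ |ξ_i|.
    have h1 := (memLp_finsetSum (Finset.range k) fun i _ => (hL i).norm).const_mul 12
    refine h1.mono ((hcm k).mono (ℱ.le k)).aestronglyMeasurable (Eventually.of_forall fun ω => ?_)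
    have h2 := partialSups_le_sum (fun i => ξ i ω) k
    have h3 := Finset.abs_sum_le_sum_abs (fun i => ξ i ω) (Finset.range k)
    have h0 : 0 ≤ partialSups (fun k => |∑ i ∈ Finset.range k, ξ i ω|) k :=
      (abs_nonneg _).trans (le_partialSups (fun k => |∑ i ∈ Finset.range k, ξ i ω|) k)
    have h4 : |Real.sign (∑ i ∈ Finset.range k, ξ i ω)| ≤ 1 := by
      rcases Real.sign_apply_eq (∑ i ∈ Finset.range k, ξ i ω) with h | h | h <;> simp [h]
    simp only [Real.norm_eq_abs]
    refine le_trans ?_ (le_abs_self _)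
    refine (abs_sub _ _).trans ?_
    rw [abs_mul, abs_mul, abs_mul, abs_of_nonneg h0]
    norm_num
    have h5 := mul_le_mul_of_nonneg_left h4 h0
    linarith
  have hci : ∀ k, Integrable (c k * ξ k) μ := fun k => (hcL k).integrable_mul (hL k)
  have hc0 : ∀ k, ∫ ω, c k ω * ξ k ω ∂μ = 0 := by
    intro k
    rw [integral_mul_condExp (ℱ.le k) (hcm k) (hci k) ((hL k).integrable one_le_two)]
    rw [integral_congr_ae (g := fun _ => 0)]
    · simp
    · filter_upwards [hc k] with ω hω
      simp [hω]
  have hsq : ∀ k, Integrable (fun ω => ξ k ω ^ 2) μ := fun k => (hL k).integrable_sq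
  have hR1 : Integrable (fun ω => 4 * ∑ k ∈ Finset.range n, ξ k ω ^ 2) μ :=
    (integrable_finsetSum _ fun k _ => hsq k).const_mul 4
  have hR2 : Integrable (fun ω => ∑ k ∈ Finset.range n, c k ω * ξ k ω) μ :=
    integrable_finsetSum _ fun k _ => hci k
  calc _ ≤ ∫ ω, (4 * ∑ k ∈ Finset.range n, ξ k ω ^ 2 +
        ∑ k ∈ Finset.range n, c k ω * ξ k ω) ∂μ :=
        integral_mono (memLp_partialSups hξ hL n).integrable_sq (hR1.add hR2)
          fun ω => sq_partialSups_le (fun k => ξ k ω) n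
    _ = _ := by
        rw [integral_add hR1 hR2, integral_const_mul, integral_finsetSum _ fun k _ => hsq k,
          integral_finsetSum _ fun k _ => show Integrable (fun ω => c k ω * ξ k ω) μ from hci k,
          Finset.sum_congr rfl fun k _ => hc0 k]
        simp

/-- Stopping when the weighted conditional variances exceed K keeps the martingale property. Doob's
inequality and summation by parts then bound the expected series by a multiple of K, and almost
every path is never stopped for some integer K. -/
theorem ae_summable_weighted_sq [IsProbabilityMeasure μ] (hξ : ∀ n, StronglyMeasurable[ℱ (n + 1)] (ξ n))
    (hL : ∀ n, MemLp (ξ n) 2 μ) (hc : ∀ n, μ[ξ n | ℱ n] =ᵐ[μ] 0) {h v : ℕ → ℝ} {C : ℝ}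
    (hC : 0 ≤ C) (hh : ∀ n, 0 ≤ h n) (hv0 : ∀ n, 0 ≤ v n)
    (hv : ∀ n, v n ≤ C * (h n - h (n + 1)))
    (hs : ∀ᵐ ω ∂μ, Summable fun n => (μ[fun ω => h n * ξ n ω ^ 2 | ℱ n]) ω) :
    ∀ᵐ ω ∂μ, Summable fun n =>
      v n * partialSups (fun k => |∑ i ∈ Finset.range k, ξ i ω|) (n + 1) ^ 2 := by
  set g : ℕ → Ω → ℝ := fun n ω => h n * ξ n ω ^ 2
  have hg : ∀ n, Integrable (g n) μ := fun n => (hL n).integrable_sq.const_mul _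
  set a : ℕ → Ω → ℝ := fun n ω => |(μ[g n | ℱ n]) ω|
  have ha : ∀ n, StronglyMeasurable[ℱ n] (a n) := fun n =>
    continuous_abs.comp_stronglyMeasurable stronglyMeasurable_condExp
  have h1 : ∀ K : ℕ, ∀ᵐ ω ∂μ, Summable fun n =>
      v n * partialSups (fun k => |∑ i ∈ Finset.range k, below a K i ω * ξ i ω|) (n + 1) ^ 2 := by
    intro K
    set ζ : ℕ → Ω → ℝ := fun n => below a K n * ξ n
    have hbm := stronglyMeasurable_below ha (K : ℝ)
    have hζ : ∀ n, StronglyMeasurable[ℱ (n + 1)] (ζ n) := fun n =>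
      ((hbm n).mono (ℱ.mono n.le_succ)).mul (hξ n)
    have hζL : ∀ n, MemLp (ζ n) 2 μ := fun n => by
      refine (hL n).mono ((hζ n).mono (ℱ.le _)).aestronglyMeasurable
        (Eventually.of_forall fun ω => ?_)
      simp only [ζ, Pi.mul_apply, norm_mul]
      exact mul_le_of_le_one_left (norm_nonneg _) (norm_below_le a K n ω)
    have hζc : ∀ n, μ[ζ n | ℱ n] =ᵐ[μ] 0 := fun n => by
      refine (condExp_mul_of_stronglyMeasurable_left (hbm n)
        ((hζL n).integrable one_le_two) ((hL n).integrable one_le_two)).trans ?_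
      filter_upwards [hc n] with ω hω
      simp [hω]
    have hζsq : ∀ n, h n * ∫ ω, ζ n ω ^ 2 ∂μ = ∫ ω, below a K n ω * g n ω ∂μ := fun n => by
      rw [← integral_const_mul]
      congr 1
      ext ω
      rcases below_eq_zero_or_one a K n ω with h | h <;> simp [ζ, g, h]
    refine ae_summable_of_sum_integral_le (C := C * (4 * K))
      (fun n => ((memLp_partialSups hζ hζL (n + 1)).integrable_sq).const_mul _)
      (fun n => Eventually.of_forall fun ω => mul_nonneg (hv0 n) (sq_nonneg _)) fun N => ?_
    calc _ ≤ ∑ n ∈ Finset.range N, v n * ∑ k ∈ Finset.range (n + 1), 4 * ∫ ω, ζ k ω ^ 2 ∂μ := by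
          refine Finset.sum_le_sum fun n _ => ?_
          rw [integral_const_mul, ← Finset.mul_sum]
          exact mul_le_mul_of_nonneg_left (integral_sq_partialSups_le hζ hζL hζc (n + 1)) (hv0 n)
      _ ≤ C * ∑ n ∈ Finset.range N, h n * (4 * ∫ ω, ζ n ω ^ 2 ∂μ) :=
          sum_mul_sum_le hC hh hv (fun n => mul_nonneg (by norm_num)
            (integral_nonneg fun ω => sq_nonneg _)) N
      _ = C * (4 * ∑ n ∈ Finset.range N, ∫ ω, below a K n ω * g n ω ∂μ) := by
          simp only [← hζsq, Finset.mul_sum]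
          exact Finset.sum_congr rfl fun n _ => by ring
      _ ≤ C * (4 * K) := by
          gcongr
          exact sum_integral_below_mul_le hg K.cast_nonneg N
  filter_upwards [hs, ae_all_iff.mpr h1] with ω hs h1
  obtain ⟨K, hK⟩ := exists_below_eq_one (a := a) (fun _ _ => abs_nonneg _) hs.abs
  simpa [hK] using h1 K

theorem ae_negligible_of_martingale_diff [IsProbabilityMeasure μ] (hξ : ∀ n, StronglyMeasurable[ℱ (n + 1)] (ξ n))
    (hL : ∀ n, MemLp (ξ n) 2 μ) (hc : ∀ n, μ[ξ n | ℱ n] =ᵐ[μ] 0) {ε : ℝ} (hε : 0 < ε)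
    (hs : ∀ᵐ ω ∂μ, Summable fun n : ℕ => Real.log ((n : ℝ) + 1) ^ (1 + ε) *
      (μ[fun ω' => ξ n ω' ^ 2 | ℱ n]) ω / ((n : ℝ) + 1) ^ 2) :
    ∀ᵐ ω ∂μ, Negligible fun n => ∑ i ∈ Finset.range n, ξ i ω := by
  -- The difference estimate for the weights needs an exponent of at most 2.
  set δ := min ε 1
  have hδ : 0 < δ := lt_min hε one_pos
  have hδ1 : δ ≤ 1 := min_le_right _ _
  have hw : ∀ n, 0 ≤ logWeight δ n / ((n : ℝ) + 1) ^ 2 := fun n =>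
    div_nonneg (logWeight_pos δ n).le (by positivity)
  have hsum : ∀ᵐ ω ∂μ, Summable fun n : ℕ =>
      (μ[fun ω' => logWeight δ n / ((n : ℝ) + 1) ^ 2 * ξ n ω' ^ 2 | ℱ n]) ω := by
    have h1 : ∀ n : ℕ, μ[fun ω' => logWeight δ n / ((n : ℝ) + 1) ^ 2 * ξ n ω' ^ 2 | ℱ n] =ᵐ[μ]
        fun ω => logWeight δ n / ((n : ℝ) + 1) ^ 2 * (μ[fun ω' => ξ n ω' ^ 2 | ℱ n]) ω :=
      fun n => condExp_smul (logWeight δ n / ((n : ℝ) + 1) ^ 2) (fun ω' => ξ n ω' ^ 2) (ℱ n)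
    have h2 : ∀ n, 0 ≤ᵐ[μ] μ[fun ω' => ξ n ω' ^ 2 | ℱ n] := fun n =>
      condExp_nonneg (Eventually.of_forall fun ω => sq_nonneg _)
    filter_upwards [hs, ae_all_iff.mpr h1, ae_all_iff.mpr h2] with ω hs h1 h2
    simp only [h1]
    refine summable_of_isBigO_nat (hs.mul_left (4 ^ (1 + ε))) (Asymptotics.IsBigO.of_bound 1 ?_)
    -- At n = 0 the given weight is a power of log 1 = 0 and controls nothing.
    filter_upwards [eventually_ge_atTop 1] with n hn
    rw [one_mul, Real.norm_of_nonneg (mul_nonneg (hw n) (h2 n))]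
    refine le_trans ?_ (le_abs_self _)
    calc _ = logWeight δ n * (μ[fun ω' => ξ n ω' ^ 2 | ℱ n]) ω / ((n : ℝ) + 1) ^ 2 := by ring
      _ ≤ (4 ^ (1 + ε) * Real.log ((n : ℝ) + 1) ^ (1 + ε)) *
          (μ[fun ω' => ξ n ω' ^ 2 | ℱ n]) ω / ((n : ℝ) + 1) ^ 2 := by
          gcongr
          · exact h2 n
          · exact logWeight_le hδ.le (min_le_left _ _) hn
      _ = _ := by ring
  have h1 := ae_summable_weighted_sq hξ hL hc (h := fun n => logWeight δ n / ((n : ℝ) + 1) ^ 2)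
    (v := fun n => logWeight δ n / ((n : ℝ) + 1) ^ 3) (C := 4) (by norm_num) hw
    (fun n => div_nonneg (logWeight_pos δ n).le (by positivity))
    (logWeight_div_cube_le hδ.le hδ1) hsum
  filter_upwards [h1] with ω h1
  exact negligible_of_summable_sq hδ h1

end Martingale

/-! ### Conditional independence and centering -/

section CondIndep

variable {Ω E : Type*} {m m0 : MeasurableSpace Ω} {μ : Measure Ω} [IsProbabilityMeasure μ]
  [MeasurableSpace E]

theorem setIntegral_mul_condExp (hm : m ≤ m0) {c f : Ω → ℝ}
    (hc : StronglyMeasurable[m] c) (hcf : Integrable (c * f) μ) (hf : Integrable f μ)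
    {S : Set Ω} (hS : MeasurableSet[m] S) :
    ∫ ω in S, c ω * f ω ∂μ = ∫ ω in S, c ω * (μ[f | m]) ω ∂μ := by
  have h1 := condExp_mul_of_stronglyMeasurable_left hc hcf hf
  calc ∫ ω in S, c ω * f ω ∂μ = ∫ ω in S, (μ[c * f | m]) ω ∂μ :=
        (setIntegral_condExp hm hcf hS).symm
    _ = _ := integral_congr_ae (ae_restrict_of_ae h1)

/-- If an event `A` and a random element `Z` are conditionally independent given `m`, then a
bounded function of `Z`, conditionally centered, has conditional mean zero on `A`. -/
theorem condExp_indicator_mul_sub (hm : m ≤ m0) {Z : Ω → E} (hZ : Measurable Z) {A : Set Ω}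
    (hA : MeasurableSet A)
    (hind : ∀ B : Set E, MeasurableSet B →
      μ[(A ∩ Z ⁻¹' B).indicator (fun _ => (1 : ℝ)) | m] =ᵐ[μ] fun ω =>
        (μ[A.indicator (fun _ => (1 : ℝ)) | m]) ω *
          (μ[(Z ⁻¹' B).indicator (fun _ => (1 : ℝ)) | m]) ω)
    {φ : E → ℝ} (hφ : Measurable φ) {C : ℝ} (hC : ∀ z, |φ z| ≤ C) :
    μ[fun ω => A.indicator (fun _ => (1 : ℝ)) ω * (φ (Z ω) - (μ[φ ∘ Z | m]) ω) | m] =ᵐ[μ] 0 := by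
  set a : Ω → ℝ := A.indicator fun _ => (1 : ℝ)
  set π : Ω → ℝ := μ[a | m]
  have haI : Integrable a μ := (integrable_const (1 : ℝ)).indicator hA
  have haB : ∀ ω, ‖a ω‖ ≤ 1 := fun ω => by
    by_cases h : ω ∈ A <;> simp [a, h]
  have hπm : StronglyMeasurable[m] π := stronglyMeasurable_condExp
  have hπI : Integrable π μ := integrable_condExp
  have hπ0 : 0 ≤ᵐ[μ] π := condExp_nonneg
    (Eventually.of_forall fun ω => Set.indicator_nonneg (fun _ _ => zero_le_one) ω)
  have hφI : Integrable (φ ∘ Z) μ := Integrable.of_bound (hφ.comp hZ).aestronglyMeasurable C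
    (Eventually.of_forall fun ω => hC (Z ω))
  have hπφ : Integrable (π * (φ ∘ Z)) μ := by
    have := hπI.bdd_mul (hφ.comp hZ).aestronglyMeasurable (Eventually.of_forall fun ω => hC (Z ω))
    exact this.congr (Eventually.of_forall fun ω => mul_comm _ _)
  have haI' : ∀ {f : Ω → ℝ}, Integrable f μ → Integrable (fun ω => a ω * f ω) μ := fun hf =>
    hf.bdd_mul haI.aestronglyMeasurable (Eventually.of_forall haB)
  have hpair : ∀ S, MeasurableSet[m] S →
      ∫ ω in S, a ω * φ (Z ω) ∂μ = ∫ ω in S, π ω * φ (Z ω) ∂μ := by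
    intro S hS
    have hdens : AEMeasurable (fun ω => ENNReal.ofReal (π ω)) (μ.restrict S) :=
      (hπm.mono hm).measurable.ennreal_ofReal.aemeasurable
    have hfin : IsFiniteMeasure ((μ.restrict S).withDensity fun ω => ENNReal.ofReal (π ω)) :=
      isFiniteMeasure_withDensity_ofReal hπI.restrict.hasFiniteIntegral
    -- Conditional independence says exactly that these two laws of Z agree on each Borel set;
    -- integrating φ extends this from indicators to bounded functions.
    have hν : (μ.restrict (S ∩ A)).map Z =
        ((μ.restrict S).withDensity fun ω => ENNReal.ofReal (π ω)).map Z := by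
      ext B hB
      have hZB := hZ hB
      have hbI : Integrable ((Z ⁻¹' B).indicator fun _ => (1 : ℝ)) μ :=
        (integrable_const (1 : ℝ)).indicator hZB
      have hπb : Integrable (π * (Z ⁻¹' B).indicator fun _ => (1 : ℝ)) μ := by
        have := hπI.indicator hZB
        refine this.congr (Eventually.of_forall fun ω => ?_)
        by_cases h : ω ∈ Z ⁻¹' B <;> simp [h]
      have h1 : ∫ ω in S, (A ∩ Z ⁻¹' B).indicator (fun _ => (1 : ℝ)) ω ∂μ =
          ∫ ω in S ∩ Z ⁻¹' B, π ω ∂μ := by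
        rw [← setIntegral_condExp hm ((integrable_const (1 : ℝ)).indicator (hA.inter hZB)) hS,
          integral_congr_ae (ae_restrict_of_ae (hind B hB)),
          ← setIntegral_mul_condExp hm hπm hπb hbI hS, ← setIntegral_indicator hZB]
        refine integral_congr_ae (Eventually.of_forall fun ω => ?_)
        by_cases h : ω ∈ Z ⁻¹' B <;> simp [h]
      rw [Measure.map_apply hZ hB, Measure.map_apply hZ hB, withDensity_apply _ hZB,
        Measure.restrict_restrict hZB, Set.inter_comm (Z ⁻¹' B) S,
        ← ofReal_integral_eq_lintegral_ofReal hπI.restrict (ae_restrict_of_ae hπ0), ← h1,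
        show ∫ ω in S, (A ∩ Z ⁻¹' B).indicator (fun _ => (1 : ℝ)) ω ∂μ = _ from
          integral_indicator_one (hA.inter hZB), measureReal_def,
        Measure.restrict_apply (hA.inter hZB), Measure.restrict_apply hZB,
        ENNReal.ofReal_toReal (measure_ne_top _ _)]
      congr 1
      ext ω
      simp only [Set.mem_inter_iff]
      tauto
    calc ∫ ω in S, a ω * φ (Z ω) ∂μ = ∫ ω in S ∩ A, φ (Z ω) ∂μ := by
          rw [← setIntegral_indicator hA]
          refine integral_congr_ae (Eventually.of_forall fun ω => ?_)
          by_cases h : ω ∈ A <;> simp [a, h]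
      _ = ∫ z, φ z ∂((μ.restrict (S ∩ A)).map Z) :=
          (integral_map hZ.aemeasurable hφ.aestronglyMeasurable).symm
      _ = ∫ ω, φ (Z ω) ∂((μ.restrict S).withDensity fun ω => ENNReal.ofReal (π ω)) := by
          rw [hν, integral_map hZ.aemeasurable hφ.aestronglyMeasurable]
      _ = ∫ ω in S, π ω * φ (Z ω) ∂μ := by
          rw [integral_withDensity_eq_integral_toReal_smul₀ hdens
            (Eventually.of_forall fun ω => ENNReal.ofReal_lt_top)]
          refine integral_congr_ae ?_
          filter_upwards [ae_restrict_of_ae hπ0] with ω hω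
          rw [ENNReal.toReal_ofReal hω, smul_eq_mul]
  have hsub : Integrable (fun ω => a ω * (φ (Z ω) - (μ[φ ∘ Z | m]) ω)) μ :=
    haI' (hφI.sub integrable_condExp)
  refine (ae_eq_condExp_of_forall_setIntegral_eq hm hsub
    (fun _ _ _ => (integrable_zero _ _ _).integrableOn) (fun S hS _ => ?_)
    aestronglyMeasurable_zero).symm
  have h1 : ∫ ω in S, a ω * (μ[φ ∘ Z | m]) ω ∂μ = ∫ ω in S, π ω * (μ[φ ∘ Z | m]) ω ∂μ := by
    have hca : Integrable ((μ[φ ∘ Z | m]) * a) μ :=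
      (haI' integrable_condExp).congr (Eventually.of_forall fun ω => mul_comm _ _)
    have := setIntegral_mul_condExp hm stronglyMeasurable_condExp hca haI hS
    simpa only [mul_comm] using this
  have h2 := setIntegral_mul_condExp hm hπm hπφ hφI hS
  simp only [Pi.zero_apply, integral_zero, mul_sub]
  rw [integral_sub (f := fun ω => a ω * φ (Z ω)) (haI' hφI).integrableOn (haI' integrable_condExp).integrableOn, h1, ← h2]
  exact (sub_eq_zero.mpr (hpair S hS)).symm

end CondIndep

/-! ### Measurability and filtration of the urn -/

section Model

variable {Ω : Type*} {d : ℕ}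

theorem N_eq_sum_range (draw : ℕ → Ω → Fin d) (n : ℕ) (ω : Ω) :
    N draw n ω = ∑ i ∈ Finset.range n, X draw (i + 1) ω := by
  induction n with
  | zero => simp [N]
  | succ n ih => rw [Finset.sum_range_succ, ← ih, N, N, Finset.sum_Icc_succ_top (by omega)]

theorem X_apply (draw : ℕ → Ω → Fin d) (m : ℕ) (q : Fin d) (ω : Ω) :
    X draw m ω q = (draw m ⁻¹' {q}).indicator (fun _ => (1 : ℝ)) ω := by
  by_cases h : draw m ω = q
  · simp [X, Set.indicator, h]
  · simp [X, Set.indicator, h, Ne.symm h]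

theorem abs_X_le (draw : ℕ → Ω → Fin d) (m : ℕ) (q : Fin d) (ω : Ω) : |X draw m ω q| ≤ 1 := by
  rw [X_apply]
  by_cases h : ω ∈ draw m ⁻¹' {q}
  · rw [Set.indicator_of_mem h]; simp
  · rw [Set.indicator_of_notMem h]; simp

theorem norm_vecMul_X_le (draw : ℕ → Ω → Fin d) (m : ℕ) (ω : Ω) (A : Matrix (Fin d) (Fin d) ℝ) :
    ‖X draw m ω ᵥ* A‖ ≤ ‖A‖ := by
  rw [X, Matrix.single_one_vecMul]
  refine (pi_norm_le_iff_of_nonneg (norm_nonneg _)).mpr fun k => ?_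
  exact A.norm_entry_le_entrywise_sup_norm

theorem measurable_entry (q k : Fin d) :
    Measurable fun A : Matrix (Fin d) (Fin d) ℝ => A q k :=
  (measurable_pi_apply k).comp (measurable_pi_apply (X := fun _ : Fin d => Fin d → ℝ) q)

theorem Negligible.vecMul {v : ℕ → Fin d → ℝ} (hv : Negligible v)
    (H : Matrix (Fin d) (Fin d) ℝ) : Negligible fun n => v n ᵥ* H := by
  refine negligible_pi fun k => ?_
  change Negligible fun n => ∑ q, v n q * H q k
  refine negligible_sum _ fun q _ => hv.of_le_add |H q k| 0 (abs_nonneg _) fun r _ hr n => ?_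
  rw [norm_mul, add_zero, mul_comm, Real.norm_eq_abs (H q k)]
  exact mul_le_mul_of_nonneg_left ((norm_le_pi_norm (v n) q).trans (hr n)) (abs_nonneg _)

theorem le_history {Y0 : Fin d → ℝ} {draw : ℕ → Ω → Fin d}
    {D : ℕ → Ω → Matrix (Fin d) (Fin d) ℝ} {m n : ℕ} (hm : 1 ≤ m) (hmn : m ≤ n) :
    MeasurableSpace.comap (X draw m) inferInstance ⊔
      MeasurableSpace.comap (Y Y0 draw D m) inferInstance ⊔
      MeasurableSpace.comap (D m) inferInstance ≤ history Y0 draw D n :=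
  le_iSup₂_of_le m (Finset.mem_Icc.mpr ⟨hm, hmn⟩) le_rfl

variable [MeasurableSpace Ω] {μ : Measure Ω} {Y0 p : Fin d → ℝ} {draw : ℕ → Ω → Fin d}
  {D : ℕ → Ω → Matrix (Fin d) (Fin d) ℝ}

theorem IsFriedmanUrn.measurable_X (hurn : IsFriedmanUrn μ Y0 p draw D) {m : ℕ} (hm : 1 ≤ m) :
    Measurable (X draw m) :=
  (Measurable.of_discrete (f := fun i : Fin d => (Pi.single i 1 : Fin d → ℝ))).comp
    (hurn.measurable_draw m hm)

theorem IsFriedmanUrn.measurable_Y (hurn : IsFriedmanUrn μ Y0 p draw D) (m : ℕ) :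
    Measurable (Y Y0 draw D m) := by
  induction m with
  | zero => exact measurable_const
  | succ m ih =>
    refine ih.add (measurable_pi_iff.mpr fun k => ?_)
    change Measurable fun ω => ∑ q, X draw (m + 1) ω q * D (m + 1) ω q k
    exact Finset.measurable_sum _ fun q _ =>
      ((measurable_pi_apply q).comp (hurn.measurable_X (by omega))).mul
        ((measurable_entry q k).comp (hurn.measurable_replacement _ (by omega)))

/-- The filtration of the urn. -/
def IsFriedmanUrn.filtration {m0 : MeasurableSpace Ω} {μ : Measure Ω}
    (hurn : IsFriedmanUrn μ Y0 p draw D) : Filtration ℕ m0 where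
  seq := history Y0 draw D
  mono' _ _ hij := biSup_mono fun _ hm =>
    Finset.mem_Icc.mpr ⟨(Finset.mem_Icc.mp hm).1, (Finset.mem_Icc.mp hm).2.trans hij⟩
  le' _ := iSup₂_le fun m hm => by
    have hm := (Finset.mem_Icc.mp hm).1
    exact sup_le (sup_le (hurn.measurable_X hm).comap_le (hurn.measurable_Y m).comap_le)
      (hurn.measurable_replacement m hm).comap_le

end Model

/-! ### Almost sure limits, part (i) -/

section Limit

variable {Ω : Type*} {d : ℕ} {m0 : MeasurableSpace Ω} {μ : Measure Ω}
  {Y0 p : Fin d → ℝ} {draw : ℕ → Ω → Fin d} {D : ℕ → Ω → Matrix (Fin d) (Fin d) ℝ}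

theorem IsFriedmanUrn.stronglyMeasurable_X (hurn : IsFriedmanUrn μ Y0 p draw D) (n : ℕ)
    (q : Fin d) : StronglyMeasurable[hurn.filtration (n + 1)] fun ω => X draw (n + 1) ω q := by
  have h1 : Measurable[hurn.filtration (n + 1)] (X draw (n + 1)) :=
    measurable_iff_comap_le.mpr ((le_sup_left.trans le_sup_left).trans
      (le_history (Y0 := Y0) (D := D) (by omega) le_rfl))
  exact ((measurable_pi_apply q).comp h1).stronglyMeasurable

theorem IsFriedmanUrn.measurable_D (hurn : IsFriedmanUrn μ Y0 p draw D) (n : ℕ) :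
    Measurable[hurn.filtration (n + 1)] (D (n + 1)) :=
  measurable_iff_comap_le.mpr (le_sup_right.trans
    (le_history (Y0 := Y0) (draw := draw) (by omega) le_rfl))

/-- An algebraic identity valid for every H and every path, so it may be applied with the random
matrix H(ω). -/
theorem Y_eq_sum (n : ℕ) (ω : Ω) (H : Matrix (Fin d) (Fin d) ℝ) :
    Y Y0 draw D n ω = N draw n ω ᵥ* H + (Y0 + M2 μ Y0 draw D n ω +
      ∑ i ∈ Finset.range n, X draw (i + 1) ω ᵥ* (condMean μ Y0 draw D i ω - H)) := by
  induction n with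
  | zero => simp [Y, N, M2]
  | succ n ih =>
    rw [Y, ih, N_eq_sum_range, N_eq_sum_range, M2, M2, Finset.sum_range_succ,
      Finset.sum_range_succ _ n, Finset.sum_range_succ _ n, Matrix.add_vecMul, Matrix.vecMul_sub,
      Matrix.vecMul_sub]
    abel

theorem summable_log_sq_div : Summable fun n : ℕ =>
    Real.log ((n : ℝ) + 1) ^ (1 + (1 : ℝ)) * 4 / ((n : ℝ) + 1) ^ 2 := by
  have h1 : Summable fun n : ℕ => 64 * (1 / (((n + 1 : ℕ) : ℝ) ^ (3 / 2 : ℝ))) :=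
    ((summable_nat_add_iff 1).mpr
      (Real.summable_one_div_nat_rpow.mpr (by norm_num : (1 : ℝ) < 3 / 2))).mul_left 64
  refine Summable.of_nonneg_of_le (fun n => ?_) (fun n => ?_) h1
  · have := Real.log_nonneg (show (1 : ℝ) ≤ n + 1 by linarith [(Nat.cast_nonneg n : (0 : ℝ) ≤ n)])
    positivity
  · have hx : (1 : ℝ) ≤ n + 1 := by linarith [(Nat.cast_nonneg n : (0 : ℝ) ≤ n)]
    push_cast
    set x : ℝ := n + 1
    have hx0 : 0 < x := by linarith
    have h2 : Real.log x ≤ 4 * x ^ (1 / 4 : ℝ) := by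
      have := Real.log_le_rpow_div hx0.le (show (0 : ℝ) < 1 / 4 by norm_num)
      linarith
    have h3 : Real.log x ^ (1 + (1 : ℝ)) ≤ 16 * x ^ (1 / 2 : ℝ) := by
      have h4 : (1 : ℝ) + 1 = ((2 : ℕ) : ℝ) := by norm_num
      rw [h4, Real.rpow_natCast]
      calc Real.log x ^ 2 ≤ (4 * x ^ (1 / 4 : ℝ)) ^ 2 :=
            pow_le_pow_left₀ (Real.log_nonneg hx) h2 2
        _ = 16 * x ^ (1 / 2 : ℝ) := by
          rw [mul_pow, ← Real.rpow_natCast, ← Real.rpow_natCast, ← Real.rpow_mul hx0.le]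
          norm_num
    have h5 : x ^ 2 = x ^ (1 / 2 : ℝ) * x ^ (3 / 2 : ℝ) := by
      rw [← Real.rpow_add hx0]; norm_num
    rw [mul_one_div, h5, div_le_div_iff₀ (by positivity) (by positivity)]
    have := Real.rpow_pos_of_pos hx0 (3 / 2)
    nlinarith

variable [IsProbabilityMeasure μ]

/-- The martingale differences are bounded by 2, so their conditional variances are at most 4 and
the logarithmic criterion holds with ε = 1. -/
theorem IsFriedmanUrn.ae_negligible_draws (hurn : IsFriedmanUrn μ Y0 p draw D) (k : Fin d) :
    ∀ᵐ ω ∂μ, Negligible fun n => ∑ i ∈ Finset.range n,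
      (X draw (i + 1) ω k - proportion p (Y Y0 draw D i ω) k) := by
  set ℱ := hurn.filtration
  set ξ : ℕ → Ω → ℝ := fun n ω =>
    X draw (n + 1) ω k - (μ[fun ω => X draw (n + 1) ω k | ℱ n]) ω
  have hX : ∀ n, StronglyMeasurable[ℱ (n + 1)] fun ω => X draw (n + 1) ω k :=
    fun n => hurn.stronglyMeasurable_X n k
  have hXI : ∀ n, Integrable (fun ω => X draw (n + 1) ω k) μ := fun n =>
    Integrable.of_bound ((hX n).mono (ℱ.le _)).aestronglyMeasurable 1
      (Eventually.of_forall fun ω => abs_X_le draw (n + 1) k ω)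
  have hξ : ∀ n, StronglyMeasurable[ℱ (n + 1)] (ξ n) := fun n =>
    (hX n).sub (stronglyMeasurable_condExp.mono (ℱ.mono n.le_succ))
  have hb : ∀ n, ∀ᵐ ω ∂μ, ‖ξ n ω‖ ≤ 2 := fun n => by
    have h1 : ∀ᵐ ω ∂μ, |(μ[fun ω => X draw (n + 1) ω k | ℱ n]) ω| ≤ 1 :=
      ae_bdd_abs_condExp_of_ae_bdd_abs
        (Eventually.of_forall fun ω => abs_X_le draw (n + 1) k ω)
    filter_upwards [h1] with ω h1
    have h2 := abs_X_le draw (n + 1) k ω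
    refine (norm_sub_le _ _).trans ?_
    simp only [Real.norm_eq_abs]
    linarith
  have hL : ∀ n, MemLp (ξ n) 2 μ := fun n =>
    MemLp.of_bound ((hξ n).mono (ℱ.le _)).aestronglyMeasurable 2 (hb n)
  have hc : ∀ n, μ[ξ n | ℱ n] =ᵐ[μ] 0 := fun n => by
    refine (condExp_sub (hXI n) integrable_condExp (ℱ n)).trans ?_
    rw [condExp_of_stronglyMeasurable (ℱ.le n) stronglyMeasurable_condExp integrable_condExp,
      sub_self]
  have hs : ∀ᵐ ω ∂μ, Summable fun n : ℕ => Real.log ((n : ℝ) + 1) ^ (1 + (1 : ℝ)) *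
      (μ[fun ω' => ξ n ω' ^ 2 | ℱ n]) ω / ((n : ℝ) + 1) ^ 2 := by
    have h1 : ∀ n, ∀ᵐ ω ∂μ, |(μ[fun ω' => ξ n ω' ^ 2 | ℱ n]) ω| ≤ 4 := fun n =>
      ae_bdd_abs_condExp_of_ae_bdd_abs <| by
        filter_upwards [hb n] with ω hω
        rw [abs_of_nonneg (sq_nonneg _), ← sq_abs]
        rw [Real.norm_eq_abs] at hω
        nlinarith [abs_nonneg (ξ n ω)]
    filter_upwards [ae_all_iff.mpr h1] with ω h1
    refine Summable.of_norm_bounded summable_log_sq_div fun n => ?_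
    have h2 := Real.log_nonneg (show (1 : ℝ) ≤ n + 1 by linarith [(Nat.cast_nonneg n : (0 : ℝ) ≤ n)])
    rw [norm_div, norm_mul, Real.norm_of_nonneg (by positivity : 0 ≤ ((n : ℝ) + 1) ^ 2),
      Real.norm_of_nonneg (Real.rpow_nonneg h2 _)]
    gcongr
    exact h1 n
  filter_upwards [ae_negligible_of_martingale_diff hξ hL hc one_pos hs,
    ae_all_iff.mpr fun n => hurn.selection n k] with ω h1 h2
  have h3 : ∀ n, X draw (n + 1) ω k - proportion p (Y Y0 draw D n ω) k = ξ n ω := fun n => by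
    rw [← h2 n]; rfl
  simpa only [h3] using h1

theorem tendsto_proportion {p : Fin d → ℝ} {y : ℕ → Fin d → ℝ} {v : Fin d → ℝ} {l : ℝ}
    (hv : v ∈ stdSimplex ℝ (Fin d)) (hl : 0 < l)
    (hy : Tendsto (fun n : ℕ => (n : ℝ)⁻¹ • y n) atTop (𝓝 (l • v))) :
    Tendsto (fun n => proportion p (y n)) atTop (𝓝 v) := by
  have h1 : ∀ k, Tendsto (fun n : ℕ => max ((n : ℝ)⁻¹ * y n k) 0) atTop (𝓝 (l * v k)) := by
    intro k
    have := ((tendsto_pi_nhds.mp hy) k).max (tendsto_const_nhds (x := (0 : ℝ)))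
    simpa [max_eq_left (mul_nonneg hl.le (hv.1 k))] using this
  have h2 : Tendsto (fun n : ℕ => ∑ j, max ((n : ℝ)⁻¹ * y n j) 0) atTop (𝓝 l) := by
    have := tendsto_finsetSum Finset.univ fun k _ => h1 k
    rwa [← Finset.mul_sum, hv.2, mul_one] at this
  refine tendsto_pi_nhds.mpr fun k => ?_
  have h3 := (h1 k).div h2 hl.ne'
  rw [mul_div_cancel_left₀ _ hl.ne'] at h3
  refine h3.congr' ?_
  filter_upwards [h2.eventually_const_lt hl, eventually_ge_atTop 1] with n hn hn1
  have hn' : (0 : ℝ) < (n : ℝ)⁻¹ := inv_pos.mpr (by exact_mod_cast hn1)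
  have h4 : ∀ j, max ((n : ℝ)⁻¹ * y n j) 0 = (n : ℝ)⁻¹ * max (y n j) 0 := fun j => by
    rw [mul_max_of_nonneg _ _ hn'.le, mul_zero]
  change max ((n : ℝ)⁻¹ * y n k) 0 / ∑ j, max ((n : ℝ)⁻¹ * y n j) 0 = _
  simp only [h4, ← Finset.mul_sum] at hn ⊢
  have h5 : ∑ j, max (y n j) 0 ≠ 0 := fun h => by simp [h] at hn
  rw [proportion, if_neg h5, mul_div_mul_left _ _ hn'.ne']

theorem Negligible.tendsto_smul {s : ℕ → Fin d → ℝ} (hs : Negligible s) :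
    Tendsto (fun n : ℕ => (n : ℝ)⁻¹ • s n) atTop (𝓝 0) := by
  refine squeeze_zero_norm (fun n => ?_) hs.tendsto_div
  rw [norm_smul, norm_inv, Real.norm_natCast, div_eq_inv_mul]

theorem IsFriedmanUrn.exists_limit (hurn : IsFriedmanUrn μ Y0 p draw D)
    {H : Ω → Matrix (Fin d) (Fin d) ℝ} (hH : ∀ᵐ ω ∂μ, Admissible (H ω))
    (hmean : ∀ᵐ ω ∂μ, Summable fun n : ℕ => ‖condMean μ Y0 draw D n ω - H ω‖ / ((n : ℝ) + 1))
    (hM : MartingaleCondition μ Y0 draw D) :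
    ∀ᵐ ω ∂μ, ∃ v ∈ eigenSimplex (H ω),
      Tendsto (fun n : ℕ => (n : ℝ)⁻¹ • Y Y0 draw D n ω) atTop (𝓝 (lam (H ω) • v)) ∧
      Tendsto (fun n : ℕ => (n : ℝ)⁻¹ • N draw n ω) atTop (𝓝 v) := by
  filter_upwards [hH, hmean, hM, ae_all_iff.mpr hurn.ae_negligible_draws] with ω hH hmean hM hdraw
  obtain ⟨u, hu, hHu⟩ := hH.exists_pos_eigenvector
  set P : ℕ → Fin d → ℝ := fun n => ∑ i ∈ Finset.range n, proportion p (Y Y0 draw D i ω)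
  have hNP : Negligible fun n => N draw n ω - P n := by
    refine negligible_pi fun k => ?_
    convert hdraw k using 2 with n
    simp only [N_eq_sum_range, P, Pi.sub_apply, Finset.sum_apply, ← Finset.sum_sub_distrib]
  have hM2 : Negligible fun n => M2 μ Y0 draw D n ω := negligible_iff_summable_sup'.mpr hM
  have hsum : Negligible fun n =>
      ∑ i ∈ Finset.range n, X draw (i + 1) ω ᵥ* (condMean μ Y0 draw D i ω - H ω) := by
    refine negligible_partial_sums
      (Summable.of_nonneg_of_le (fun n => by positivity) (fun n => ?_) hmean)
    gcongr
    exact norm_vecMul_X_le _ _ _ _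
  have hR : Negligible fun n => Y Y0 draw D n ω - P n ᵥ* H ω := by
    convert (hNP.vecMul (H ω)).add (((negligible_const Y0).add hM2).add hsum) using 2 with n
    rw [Y_eq_sum (μ := μ) n ω (H ω), Matrix.sub_vecMul]
    abel
  obtain ⟨v, hv, hvH, hP⟩ := tendsto_of_proportion_drift (Y := fun n => Y Y0 draw D n ω)
    hH.offDiag_nonneg hu hHu hH.lam_pos hurn.default_mem (P := P) (by simp [P])
    (fun n => Finset.sum_range_succ _ _) (fun n => (add_sub_cancel _ _).symm) hR
  refine ⟨v, ⟨hv, hvH⟩, ?_, ?_⟩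
  · have hc : Continuous fun z : Fin d → ℝ => z ᵥ* H ω := by
      refine continuous_pi fun k => ?_
      change Continuous fun z : Fin d → ℝ => ∑ q, z q * H ω q k
      fun_prop
    have h1 := ((hc.tendsto v).comp hP).add hR.tendsto_smul
    rw [add_zero, hvH] at h1
    refine h1.congr fun n => ?_
    rw [Function.comp_apply, Matrix.smul_vecMul, ← smul_add, add_sub_cancel]
  · have h1 := hP.add hNP.tendsto_smul
    rw [add_zero] at h1
    refine h1.congr fun n => ?_
    rw [← smul_add, add_sub_cancel]

theorem IsFriedmanUrn.exists_measurable_limit (hurn : IsFriedmanUrn μ Y0 p draw D)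
    {H : Ω → Matrix (Fin d) (Fin d) ℝ} (hH : ∀ᵐ ω ∂μ, Admissible (H ω))
    (hmean : ∀ᵐ ω ∂μ, Summable fun n : ℕ => ‖condMean μ Y0 draw D n ω - H ω‖ / ((n : ℝ) + 1))
    (hM : MartingaleCondition μ Y0 draw D) :
    ∃ V : Ω → Fin d → ℝ, Measurable V ∧
      (∀ᵐ ω ∂μ, V ω ∈ eigenSimplex (H ω)) ∧
      (∀ᵐ ω ∂μ, Tendsto (fun n : ℕ => (n : ℝ)⁻¹ • Y Y0 draw D n ω) atTop
        (𝓝 (lam (H ω) • V ω))) ∧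
      (∀ᵐ ω ∂μ, Tendsto (fun n : ℕ => proportion p (Y Y0 draw D n ω)) atTop (𝓝 (V ω))) ∧
      (∀ᵐ ω ∂μ, Tendsto (fun n : ℕ => (n : ℝ)⁻¹ • N draw n ω) atTop (𝓝 (V ω))) := by
  have hlim := hurn.exists_limit hH hmean hM
  have hN : ∀ n : ℕ, Measurable fun ω => (n : ℝ)⁻¹ • N draw n ω := fun n => by
    have h1 : Measurable (N draw n) :=
      Finset.measurable_sum _ fun m hm => hurn.measurable_X (Finset.mem_Icc.mp hm).1
    exact h1.const_smul (n : ℝ)⁻¹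
  -- The pathwise limits were chosen with no regard to measurability; uniqueness of the limit of
  -- N_n/n identifies them almost surely with a measurable V.
  obtain ⟨V, hVm, hV⟩ := measurable_limit_of_tendsto_metrizable_ae (fun n => (hN n).aemeasurable)
    (hlim.mono fun ω ⟨v, _, _, hv⟩ => ⟨v, hv⟩)
  have key : ∀ᵐ ω ∂μ, V ω ∈ eigenSimplex (H ω) ∧
      Tendsto (fun n : ℕ => (n : ℝ)⁻¹ • Y Y0 draw D n ω) atTop (𝓝 (lam (H ω) • V ω)) := by
    filter_upwards [hlim, hV] with ω ⟨v, hv, hY, hN⟩ hV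
    rw [tendsto_nhds_unique hV hN]
    exact ⟨hv, hY⟩
  refine ⟨V, hVm, key.mono fun ω h => h.1, key.mono fun ω h => h.2, ?_, hV⟩
  filter_upwards [key, hH] with ω h hH
  exact tendsto_proportion h.1.1 hH.lam_pos h.2

end Limit

/-! ### Truncated moments, part (ii) -/

section Truncation

variable {Ω : Type*} {d : ℕ} {m0 : MeasurableSpace Ω} {μ : Measure Ω} [IsProbabilityMeasure μ]
  {Y0 p : Fin d → ℝ} {draw : ℕ → Ω → Fin d} {D : ℕ → Ω → Matrix (Fin d) (Fin d) ℝ}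

/-- Truncation at level `c`. -/
noncomputable def trunc (c x : ℝ) : ℝ := {x : ℝ | |x| ≤ c}.indicator id x

theorem measurable_trunc (c : ℝ) : Measurable (trunc c) :=
  measurable_id.indicator (measurableSet_le measurable_norm measurable_const)

theorem abs_trunc_le {c : ℝ} (hc : 0 ≤ c) (x : ℝ) : |trunc c x| ≤ c := by
  by_cases h : x ∈ {x : ℝ | |x| ≤ c}
  · rw [trunc, Set.indicator_of_mem h]; exact h
  · rw [trunc, Set.indicator_of_notMem h, abs_zero]; exact hc

theorem truncLe_eq (m : ℕ) (q k : Fin d) (c : ℝ) :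
    truncLe D m q k c = fun ω => trunc c (D m ω q k) := by
  ext ω
  by_cases h : |D m ω q k| ≤ c <;> simp [truncLe, trunc, Set.indicator, h]

theorem abs_sub_truncLe_le (m : ℕ) (q k : Fin d) (c : ℝ) (ω : Ω) :
    |D m ω q k - truncLe D m q k c ω| ≤ tailGe D m q k c ω := by
  by_cases h : |D m ω q k| ≤ c
  · have h1 : truncLe D m q k c ω = D m ω q k := by simp [truncLe, Set.indicator, h]
    rw [h1, sub_self, abs_zero]
    exact Set.indicator_nonneg (fun _ _ => abs_nonneg _) ω
  · have h1 : truncLe D m q k c ω = 0 := by simp [truncLe, Set.indicator, h]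
    have h2 : tailGe D m q k c ω = |D m ω q k| := by
      simp [tailGe, Set.indicator, (not_le.mp h).le]
    rw [h1, h2, sub_zero]

theorem IsFriedmanUrn.ae_negligible_trunc (hurn : IsFriedmanUrn μ Y0 p draw D)
    (hind : CondIndepDraws μ Y0 draw D) (q k : Fin d) {c : ℕ → ℝ} (hc : ∀ m, 0 < c m) {ε : ℝ}
    (hε : 0 < ε)
    (hs : ∀ᵐ ω ∂μ, Summable fun n : ℕ => Real.log ((n : ℝ) + 1) ^ (1 + ε) *
        (μ[fun ω' => centeredTrunc μ Y0 draw D n q k (c (n + 1)) ω' ^ 2 | history Y0 draw D n]) ω /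
        ((n : ℝ) + 1) ^ 2) :
    ∀ᵐ ω ∂μ, Negligible fun n => ∑ i ∈ Finset.range n,
      X draw (i + 1) ω q * centeredTrunc μ Y0 draw D i q k (c (i + 1)) ω := by
  set ℱ := hurn.filtration
  set T : ℕ → Ω → ℝ := fun n => centeredTrunc μ Y0 draw D n q k (c (n + 1))
  have htr : ∀ n, StronglyMeasurable[ℱ (n + 1)] (truncLe D (n + 1) q k (c (n + 1))) := fun n => by
    rw [truncLe_eq]
    exact ((measurable_trunc _).comp
      ((measurable_entry q k).comp (hurn.measurable_D n))).stronglyMeasurable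
  have hT : ∀ n, StronglyMeasurable[ℱ (n + 1)] (T n) := fun n =>
    (htr n).sub (stronglyMeasurable_condExp.mono (ℱ.mono n.le_succ))
  have hξ : ∀ n, StronglyMeasurable[ℱ (n + 1)] fun ω => X draw (n + 1) ω q * T n ω :=
    fun n => (hurn.stronglyMeasurable_X n q).mul (hT n)
  have hTb : ∀ n, ∀ᵐ ω ∂μ, ‖T n ω‖ ≤ 2 * c (n + 1) := fun n => by
    have h0 : ∀ ω, |truncLe D (n + 1) q k (c (n + 1)) ω| ≤ c (n + 1) := fun ω => by
      rw [truncLe_eq]; exact abs_trunc_le (hc _).le _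
    have h1 : ∀ᵐ ω ∂μ, |(μ[truncLe D (n + 1) q k (c (n + 1)) | ℱ n]) ω| ≤ c (n + 1) :=
      ae_bdd_abs_condExp_of_ae_bdd_abs (Eventually.of_forall h0)
    filter_upwards [h1] with ω h1
    refine (norm_sub_le _ _).trans ?_
    have h2 := h0 ω
    simp only [Real.norm_eq_abs]
    change _ + |(μ[truncLe D (n + 1) q k (c (n + 1)) | ℱ n]) ω| ≤ _
    linarith
  have hξT : ∀ n ω, |X draw (n + 1) ω q * T n ω| ≤ |T n ω| := fun n ω => by
    rw [abs_mul]
    exact mul_le_of_le_one_left (abs_nonneg _) (abs_X_le draw (n + 1) q ω)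
  have hTL : ∀ n, MemLp (T n) 2 μ := fun n =>
    MemLp.of_bound ((hT n).mono (ℱ.le _)).aestronglyMeasurable _ (hTb n)
  have hL : ∀ n, MemLp (fun ω => X draw (n + 1) ω q * T n ω) 2 μ := fun n =>
    (hTL n).mono ((hξ n).mono (ℱ.le _)).aestronglyMeasurable (Eventually.of_forall (hξT n))
  -- This is where conditional independence enters: without it, multiplying by X could destroy the
  -- centering.
  have hmean : ∀ n, μ[fun ω => X draw (n + 1) ω q * T n ω | ℱ n] =ᵐ[μ] 0 := fun n => by
    have h1 := condExp_indicator_mul_sub (ℱ.le n) (hurn.measurable_replacement (n + 1) (by omega))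
      (hurn.measurable_draw (n + 1) (by omega) (measurableSet_singleton q))
      (fun B hB => hind n q B hB) ((measurable_trunc (c (n + 1))).comp (measurable_entry q k))
      (fun A => abs_trunc_le (hc (n + 1)).le (A q k))
    convert h1 using 2
    ext ω
    simp only [T, centeredTrunc, X_apply, truncLe_eq]
    rfl
  have hsq : ∀ᵐ ω ∂μ, Summable fun n : ℕ => Real.log ((n : ℝ) + 1) ^ (1 + ε) *
      (μ[fun ω' => (X draw (n + 1) ω' q * T n ω') ^ 2 | ℱ n]) ω / ((n : ℝ) + 1) ^ 2 := by
    have h1 : ∀ n, 0 ≤ᵐ[μ] μ[fun ω' => (X draw (n + 1) ω' q * T n ω') ^ 2 | ℱ n] := fun n =>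
      condExp_nonneg (Eventually.of_forall fun ω => sq_nonneg _)
    have h2 : ∀ n, μ[fun ω' => (X draw (n + 1) ω' q * T n ω') ^ 2 | ℱ n] ≤ᵐ[μ]
        μ[fun ω' => T n ω' ^ 2 | ℱ n] := fun n =>
      condExp_mono (hL n).integrable_sq (hTL n).integrable_sq
        (Eventually.of_forall fun ω => sq_le_sq.mpr (hξT n ω))
    filter_upwards [hs, ae_all_iff.mpr h1, ae_all_iff.mpr h2] with ω hs h1 h2
    refine Summable.of_nonneg_of_le (fun n => ?_) (fun n => ?_) hs
    all_goals
      have h3 := Real.rpow_nonneg (Real.log_nonneg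
        (show (1 : ℝ) ≤ n + 1 by linarith [(Nat.cast_nonneg n : (0 : ℝ) ≤ n)])) (1 + ε)
    · exact div_nonneg (mul_nonneg h3 (h1 n)) (by positivity)
    · gcongr
      exact h2 n
  exact ae_negligible_of_martingale_diff hξ hL hmean hε hsq

/-- No cancellation is needed: the terms are dominated by the tail plus its conditional mean, and
summability of the conditional means divided by m passes to the tails themselves. -/
theorem IsFriedmanUrn.ae_negligible_tail (hurn : IsFriedmanUrn μ Y0 p draw D) (q k : Fin d)
    (c : ℕ → ℝ)
    (hs : ∀ᵐ ω ∂μ, Summable fun n : ℕ =>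
      (μ[tailGe D (n + 1) q k (c (n + 1)) | history Y0 draw D n]) ω / ((n : ℝ) + 1)) :
    ∀ᵐ ω ∂μ, Negligible fun n => ∑ i ∈ Finset.range n, X draw (i + 1) ω q *
      (D (i + 1) ω q k - truncLe D (i + 1) q k (c (i + 1)) ω -
        (μ[fun ω' => D (i + 1) ω' q k - truncLe D (i + 1) q k (c (i + 1)) ω' |
          history Y0 draw D i]) ω) := by
  set ℱ := hurn.filtration
  set R : ℕ → Ω → ℝ := fun n ω => D (n + 1) ω q k - truncLe D (n + 1) q k (c (n + 1)) ω
  set t : ℕ → Ω → ℝ := fun n => tailGe D (n + 1) q k (c (n + 1))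
  have hDm : ∀ n, Measurable fun ω => D (n + 1) ω q k := fun n =>
    (measurable_entry q k).comp (hurn.measurable_replacement (n + 1) (by omega))
  have hDI : ∀ n, Integrable (fun ω => D (n + 1) ω q k) μ := fun n =>
    hurn.integrable_replacement (n + 1) (by omega) q k
  have htI : ∀ n, Integrable (t n) μ := fun n =>
    (hDI n).abs.indicator (measurableSet_le measurable_const (hDm n).norm)
  have hRI : ∀ n, Integrable (R n) μ := fun n => by
    refine (hDI n).sub ((hDI n).indicator (measurableSet_le (hDm n).norm measurable_const))
  have hRt : ∀ n ω, |R n ω| ≤ t n ω := fun n ω => abs_sub_truncLe_le (n + 1) q k (c (n + 1)) ω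
  have h1 : ∀ n, ∀ᵐ ω ∂μ, |(μ[R n | ℱ n]) ω| ≤ (μ[t n | ℱ n]) ω := fun n => by
    have h2 := condExp_mono (m := ℱ n) (hRI n) (htI n)
      (Eventually.of_forall fun ω => (abs_le.mp (hRt n ω)).2)
    have h3 := condExp_mono (m := ℱ n) (htI n).neg (hRI n)
      (Eventually.of_forall fun ω => (abs_le.mp (hRt n ω)).1)
    filter_upwards [h2, h3, condExp_neg (t n) (ℱ n)] with ω h2 h3 h4
    rw [h4] at h3
    exact abs_le.mpr ⟨h3, h2⟩
  have h2 : ∀ᵐ ω ∂μ, Summable fun n : ℕ => ((n : ℝ) + 1)⁻¹ * t n ω := by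
    refine ae_summable_of_condExp (ℱ := ℱ) (g := fun n ω => ((n : ℝ) + 1)⁻¹ * t n ω)
      (fun n => (htI n).const_mul _) (fun n => Eventually.of_forall fun ω =>
        mul_nonneg (by positivity) ((abs_nonneg _).trans (hRt n ω))) ?_
    have h3 : ∀ n : ℕ, μ[fun ω => ((n : ℝ) + 1)⁻¹ * t n ω | ℱ n] =ᵐ[μ]
        fun ω => ((n : ℝ) + 1)⁻¹ * (μ[t n | ℱ n]) ω := fun n =>
      condExp_smul ((n : ℝ) + 1)⁻¹ (t n) (ℱ n)
    filter_upwards [hs, ae_all_iff.mpr h3] with ω hs h3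
    simp only [h3]
    exact hs.congr fun n => div_eq_inv_mul _ _
  filter_upwards [hs, h2, ae_all_iff.mpr h1] with ω hs h2 h1
  refine negligible_partial_sums
    (Summable.of_nonneg_of_le (fun n => by positivity) (fun n => ?_) (h2.add hs))
  rw [← div_eq_inv_mul, ← add_div]
  gcongr
  rw [norm_mul]
  refine (mul_le_of_le_one_left (norm_nonneg _) (abs_X_le draw (n + 1) q ω)).trans ?_
  refine (norm_sub_le _ _).trans ?_
  exact add_le_add (hRt n ω) (h1 n)

theorem IsFriedmanUrn.martingaleCondition (hurn : IsFriedmanUrn μ Y0 p draw D)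
    (hind : CondIndepDraws μ Y0 draw D) (hmom : TruncatedMomentCondition μ Y0 draw D) :
    MartingaleCondition μ Y0 draw D := by
  have key : ∀ q k, ∀ᵐ ω ∂μ, Negligible fun n => ∑ i ∈ Finset.range n,
      X draw (i + 1) ω q * (D (i + 1) ω q k - condMean μ Y0 draw D i ω q k) := by
    intro q k
    obtain ⟨c, hc, htail, ε, hε, htr⟩ := hmom q k
    have hDI : ∀ n, Integrable (fun ω => D (n + 1) ω q k) μ := fun n =>
      hurn.integrable_replacement (n + 1) (by omega) q k
    have hcm : ∀ n, μ[fun ω => D (n + 1) ω q k - truncLe D (n + 1) q k (c (n + 1)) ω |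
        history Y0 draw D n] =ᵐ[μ] fun ω => (μ[fun ω => D (n + 1) ω q k | history Y0 draw D n]) ω -
          (μ[truncLe D (n + 1) q k (c (n + 1)) | history Y0 draw D n]) ω := fun n =>
      condExp_sub (hDI n) ((hDI n).indicator (measurableSet_le ((measurable_entry q k).comp
        (hurn.measurable_replacement (n + 1) (by omega))).norm measurable_const)) _
    filter_upwards [hurn.ae_negligible_trunc hind q k hc hε htr,
      hurn.ae_negligible_tail q k c htail, ae_all_iff.mpr hcm] with ω h1 h2 hcm
    refine (h1.add h2).mono fun n => le_of_eq ?_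
    rw [← Finset.sum_add_distrib]
    congr 1
    refine Finset.sum_congr rfl fun i _ => ?_
    rw [hcm i]
    simp only [centeredTrunc, condMean, Matrix.of_apply]
    ring
  have key' := ae_all_iff.mpr fun q => ae_all_iff.mpr fun k => key q k
  filter_upwards [key'] with ω h
  refine negligible_iff_summable_sup'.mp (negligible_pi fun k => ?_)
  refine (negligible_sum Finset.univ fun q _ => h q k).mono fun n => le_of_eq ?_
  congr 1
  rw [M2, Finset.sum_apply, Finset.sum_comm]
  rfl

end Truncation

end Urn

theorem theorem3p3 {Ω : Type*} [MeasurableSpace Ω] (μ : Measure Ω) [IsProbabilityMeasure μ]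
    (d : ℕ) (Y0 p : Fin d → ℝ) (draw : ℕ → Ω → Fin d)
    (D : ℕ → Ω → Matrix (Fin d) (Fin d) ℝ) (hurn : Urn.IsFriedmanUrn μ Y0 p draw D) :
    (∀ H : Ω → Matrix (Fin d) (Fin d) ℝ, Measurable H →
      (∀ᵐ ω ∂μ, Urn.Admissible (H ω)) →
      (∀ᵐ ω ∂μ, Summable fun n : ℕ =>
        ‖Urn.condMean μ Y0 draw D n ω - H ω‖ / ((n : ℝ) + 1)) →
      Urn.MartingaleCondition μ Y0 draw D →
      ∃ V : Ω → Fin d → ℝ, Measurable V ∧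
        (∀ᵐ ω ∂μ, V ω ∈ Urn.eigenSimplex (H ω)) ∧
        (∀ᵐ ω ∂μ, Tendsto (fun n : ℕ => (n : ℝ)⁻¹ • Urn.Y Y0 draw D n ω) atTop
          (𝓝 (Urn.lam (H ω) • V ω))) ∧
        (∀ᵐ ω ∂μ, Tendsto (fun n : ℕ => Urn.proportion p (Urn.Y Y0 draw D n ω)) atTop
          (𝓝 (V ω))) ∧
        (∀ᵐ ω ∂μ, Tendsto (fun n : ℕ => (n : ℝ)⁻¹ • Urn.N draw n ω) atTop (𝓝 (V ω)))) ∧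
    (Urn.CondIndepDraws μ Y0 draw D → Urn.TruncatedMomentCondition μ Y0 draw D →
      Urn.MartingaleCondition μ Y0 draw D) :=
  ⟨fun _ _ hH hmean hM => hurn.exists_measurable_limit hH hmean hM,
    fun hind hmom => hurn.martingaleCondition hind hmom⟩
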